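/- Let $n\ge 1$, let $\mathbf D=\mathbb R[\tau]/(\tau^2-1)$ be the algebra of double numbers, with conjugation $\overline{x+\tau y}=x-\tau y$, and equip $\mathbf D^n=\mathbb R^n\oplus\tau\mathbb R^n$ with the real inner product $\langle z,w\rangle=\mathrm{Re}\sum_j z_j\bar w_j$ of signature $(n,n)$. A real $n$-plane $P\subset\mathbf D^n$ is space-like if $\langle\cdot,\cdot\rangle|_P$ is positive definite. Then $P$ is the graph $\{x+\tau Ax : x\in\mathbb R^n\}$ of a real matrix $A$, and an oriented space-like $n$-plane is called positive if its orientation is the one carried over from $\mathbb R^n$ by $x\mapsto x+\tau Ax$. An oriented $n$-plane is split special Lagrangian (split SLAG) if it is the image of the standard oriented $\mathbb R^n\subset\mathbf D^n$ under some $A\in \mathrm{SU}_n(\mathbf D)=\{A\in M_n(\mathbf D): AA^*=I,\ \det_{\mathbf D}A=1\}$. All submanifolds below are embedded oriented $C^1$ submanifolds of $\mathbf D^n$ of dimension $n$, with possibly empty boundary. Such a submanifold is called positive space-like (respectively split SLAG) if all its oriented tangent planes are. A space-like submanifold carries the volume of its induced Riemannian metric. **Theorem 5.3.** Let $M$ be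 a compact oriented submanifold with boundary of $\mathbf D^n$ which is split SLAG. Then for every compact positive space-like submanifold $N$ with boundary of $\mathbf D^n$ such that $\partial N=\partial M$ as oriented manifolds (the boundaries coincide as sets and carry the same boundary orientation), $$\mathrm{vol}(M)\ \ge\ \mathrm{vol}(N),$$ and equality holds if and only if $N$ is also split SLAG. -/

import Mathlib

open scoped ContDiff
open MeasureTheory

noncomputable section

namespace SplitSLAG

/-- The algebra of double numbers `x + τ y`, `τ² = 1`. The conjugation `x + τ y ↦ x - τ y` is
`star`. -/
abbrev Double : Type := QuadraticAlgebra ℝ 1 0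

/-- The space `Dⁿ = ℝⁿ ⊕ τ ℝⁿ` as a real normed space: a point is a pair `(x, y)`, standing for
`x + τ y`. -/
abbrev DSpace (n : ℕ) : Type := (Fin n → ℝ) × (Fin n → ℝ)

/-- The coordinates `z_j = x_j + τ y_j` of a point `(x, y)` of `Dⁿ`. -/
def toDouble {n : ℕ} (z : DSpace n) : Fin n → Double := fun j => ⟨z.1 j, z.2 j⟩

/-- The point of `Dⁿ` with given double coordinates; inverse of `toDouble`. -/
def ofDouble {n : ℕ} (z : Fin n → Double) : DSpace n := (fun j => (z j).re, fun j => (z j).im)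

/-- The real inner product `⟨z, w⟩ = Re ∑ z_j * conj w_j` of split signature on `Dⁿ`. -/
def splitInner {n : ℕ} (z w : DSpace n) : ℝ := (∑ j, toDouble z j * star (toDouble w j)).re

theorem splitInner_eq {n : ℕ} (z w : DSpace n) :
    splitInner z w = ∑ j, (z.1 j * w.1 j - z.2 j * w.2 j) := by
  have h : ∀ s : Finset (Fin n), ∀ f : Fin n → Double,
      (∑ j ∈ s, f j).re = ∑ j ∈ s, (f j).re := fun s f =>
    map_sum (AddMonoidHom.mk' (fun d : Double => d.re) (fun _ _ => rfl)) f s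
  simp [splitInner, h, toDouble, sub_eq_add_neg]

/-- The standard basis vector `e_i` of `ℝⁿ ⊆ Dⁿ`. -/
def stdVec {n : ℕ} (i : Fin n) : DSpace n := (Pi.single i 1, 0)

/-- The family `v` of vectors of `Dⁿ` is a basis of the real subspace `P` that is positively
oriented for the orientation `o` of `P`. -/
def IsOrientedBasis {n : ℕ} (P : Submodule ℝ (DSpace n)) (o : Orientation ℝ P (Fin n))
    (v : Fin n → DSpace n) : Prop :=
  ∃ b : Module.Basis (Fin n) ℝ P, (∀ i, (b i : DSpace n) = v i) ∧ b.orientation = o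

/-- The oriented `n`-plane `(P, o)` is positive space-like: the inner product is positive definite
on `P`, and `(P, o)` is the graph of a real matrix `A`, with the orientation
carried over from the standard one of `ℝⁿ` by `x ↦ x + τ A x`. -/
def IsPositiveSpacelikePlane {n : ℕ} (P : Submodule ℝ (DSpace n))
    (o : Orientation ℝ P (Fin n)) : Prop :=
  (∀ z ∈ P, z ≠ 0 → 0 < splitInner z z) ∧
    ∃ A : Matrix (Fin n) (Fin n) ℝ,
      IsOrientedBasis P o (fun i => (Pi.single i 1, A.mulVec (Pi.single i 1)))

/-- The oriented `n`-plane `(P, o)` is split special Lagrangian: it is the image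
of the standard oriented `ℝⁿ ⊆ Dⁿ` under some `A ∈ SU_n(D)`
(i.e. `A A* = A* A = 1` and `det_D A = 1`). -/
def IsSplitSLAGPlane {n : ℕ} (P : Submodule ℝ (DSpace n))
    (o : Orientation ℝ P (Fin n)) : Prop :=
  ∃ A ∈ Matrix.specialUnitaryGroup (Fin n) Double,
    IsOrientedBasis P o (fun i => ofDouble (A.mulVec (toDouble (stdVec i))))

/-- A `C¹` chart of `Dⁿ` that flattens `M` to the half-space `{t ∈ ℝⁿ | 0 ≤ t₀}`: a `C¹`
diffeomorphism `φ` between open subsets of `Dⁿ` and of `ℝⁿ × ℝⁿ` such that a point `z` of the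
domain lies in `M` iff `φ z = (t, 0)` with `0 ≤ t₀`.
(Around interior points of `M` one has `0 < t₀`.) -/
structure HalfSpaceChart {n : ℕ} [NeZero n] (M : Set (DSpace n)) where
  φ : OpenPartialHomeomorph (DSpace n) ((Fin n → ℝ) × (Fin n → ℝ))
  contDiffOn : ContDiffOn ℝ 1 φ φ.source
  contDiffOn_symm : ContDiffOn ℝ 1 φ.symm φ.target
  mem_iff : ∀ z ∈ φ.source, z ∈ M ↔ 0 ≤ (φ z).1 0 ∧ (φ z).2 = 0

/-- The coordinate frame `∂/∂t_i` on `M` of a chart, at the point with coordinates `t`. -/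
def HalfSpaceChart.frame {n : ℕ} [NeZero n] {M : Set (DSpace n)} (c : HalfSpaceChart M)
    (t : Fin n → ℝ) (i : Fin n) : DSpace n :=
  fderiv ℝ c.φ.symm (t, 0) (Pi.single i 1, 0)

/-- The set of coordinates `t` of points of `M` in the domain of the chart. -/
def HalfSpaceChart.dom {n : ℕ} [NeZero n] {M : Set (DSpace n)} (c : HalfSpaceChart M) :
    Set (Fin n → ℝ) :=
  {t | (t, 0) ∈ c.φ.target ∧ 0 ≤ t 0}

/-- `M` is an (embedded) `n`-dimensional `C¹` submanifold of `Dⁿ` with (possibly empty)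
boundary. -/
def IsSubmanifoldWithBoundary {n : ℕ} [NeZero n] (M : Set (DSpace n)) : Prop :=
  ∀ p ∈ M, ∃ c : HalfSpaceChart M, p ∈ c.φ.source

/-- The boundary `∂M`: the points of `M` that lie on `{t₀ = 0}` in some chart. -/
def boundary {n : ℕ} [NeZero n] (M : Set (DSpace n)) : Set (DSpace n) :=
  {p | p ∈ M ∧ ∃ c : HalfSpaceChart M, p ∈ c.φ.source ∧ (c.φ p).1 0 = 0}

/-- The tangent space of a submanifold `M` of `Dⁿ` (with or without boundary) at `p`: the span of
the limits of secant directions. At a boundary point this is the full tangent space, of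
dimension `dim M`. -/
def tangentSpace {n : ℕ} (M : Set (DSpace n)) (p : DSpace n) : Submodule ℝ (DSpace n) :=
  Submodule.span ℝ (tangentConeAt ℝ M p)

/-- A `C¹` oriented `n`-dimensional submanifold of `Dⁿ` with boundary: a submanifold with an
orientation of each tangent space such that, around each point, some chart has its coordinate
frames all positively oriented or all negatively oriented. -/
structure OrientedSubmanifold (n : ℕ) [NeZero n] where
  carrier : Set (DSpace n)
  isSubmanifold : IsSubmanifoldWithBoundary carrier
  orientation : ∀ p : carrier, Orientation ℝ (tangentSpace carrier (p : DSpace n)) (Fin n)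
  orientation_continuous : ∀ p ∈ carrier, ∃ c : HalfSpaceChart carrier, p ∈ c.φ.source ∧
    ((∀ q : carrier, (q : DSpace n) ∈ c.φ.source →
        IsOrientedBasis (tangentSpace carrier (q : DSpace n)) (orientation q)
          (c.frame (c.φ q).1)) ∨
      (∀ q : carrier, (q : DSpace n) ∈ c.φ.source →
        IsOrientedBasis (tangentSpace carrier (q : DSpace n)) (-orientation q)
          (c.frame (c.φ q).1)))

namespace OrientedSubmanifold

variable {n : ℕ} [NeZero n]

/-- All oriented tangent planes (also at boundary points) are positive space-like. -/
def IsPositiveSpacelike (M : OrientedSubmanifold n) : Prop :=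
  ∀ p : M.carrier, IsPositiveSpacelikePlane (tangentSpace M.carrier (p : DSpace n))
    (M.orientation p)

/-- All oriented tangent planes (also at boundary points) are split special Lagrangian. -/
def IsSplitSLAG (M : OrientedSubmanifold n) : Prop :=
  ∀ p : M.carrier, IsSplitSLAGPlane (tangentSpace M.carrier (p : DSpace n))
    (M.orientation p)

/-- The tangent vector `ν` of `M` at the boundary point `p` points out of `M`. -/
def IsOutward (M : OrientedSubmanifold n) (p ν : DSpace n) : Prop :=
  ν ∈ tangentSpace M.carrier p ∧
    ∃ c : HalfSpaceChart M.carrier, p ∈ c.φ.source ∧ (fderiv ℝ c.φ p ν).1 0 < 0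

/-- The family `w` of `n - 1` vectors (indexed by the nonzero elements of `Fin n`) is a positive
basis of the tangent space of `∂M` at `p`, for the boundary orientation: for some outward vector
`ν` the basis `(ν, w)` of the tangent space of `M` is positive. If `n = 1`, then `w` is empty, and
the condition says that the boundary point `p` has sign `+`. -/
def IsPositiveBoundaryFrame (M : OrientedSubmanifold n) (p : DSpace n)
    (w : {i : Fin n // i ≠ 0} → DSpace n) : Prop :=
  (∀ i, w i ∈ tangentSpace (boundary M.carrier) p) ∧
    ∃ ν, M.IsOutward p ν ∧ ∃ hp : p ∈ M.carrier,
      IsOrientedBasis (tangentSpace M.carrier p) (M.orientation ⟨p, hp⟩)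
        (fun i => if h : i = 0 then ν else w ⟨i, h⟩)

/-- `∂M = ∂N` as oriented manifolds: the boundaries are the same set, and carry the same boundary
orientation. -/
def SameOrientedBoundary (M N : OrientedSubmanifold n) : Prop :=
  boundary M.carrier = boundary N.carrier ∧
    ∀ p ∈ boundary M.carrier, ∀ w : {i : Fin n // i ≠ 0} → DSpace n,
      M.IsPositiveBoundaryFrame p w ↔ N.IsPositiveBoundaryFrame p w

/-- The volume density `√det(⟨∂/∂t_i, ∂/∂t_j⟩)` of the induced metric in a chart. -/
def volumeDensity (M : OrientedSubmanifold n) (c : HalfSpaceChart M.carrier)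
    (t : Fin n → ℝ) : ℝ :=
  Real.sqrt (Matrix.of fun i j => splitInner (c.frame t i) (c.frame t j)).det

/-- The volume measure of the part of `M` in the domain of a chart: the image under the
parametrization `t ↦ φ⁻¹(t, 0)` of `√det(⟨∂/∂t_i, ∂/∂t_j⟩) dt`. -/
def chartVolume (M : OrientedSubmanifold n) (c : HalfSpaceChart M.carrier) :
    Measure (DSpace n) :=
  (((volume : Measure (Fin n → ℝ)).restrict c.dom).withDensity
    (fun t => ENNReal.ofReal (M.volumeDensity c t))).map (fun t => c.φ.symm (t, 0))

/-- The volume measure of a space-like submanifold `M`, with the induced metric. The measures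
`chartVolume` of the charts agree on overlaps; their supremum in the lattice of
measures is the measure carried by `M` that restricts to `M.chartVolume c` on the domain of each
chart `c`. -/
def volumeMeasure (M : OrientedSubmanifold n) : Measure (DSpace n) :=
  ⨆ c : HalfSpaceChart M.carrier, M.chartVolume c

/-- The total volume of a space-like submanifold `M`. -/
def vol (M : OrientedSubmanifold n) : ENNReal := M.volumeMeasure M.carrier

end OrientedSubmanifold

end SplitSLAG

end

/-! This is a calibration argument for Φ = Re (dz₁ ∧ … ∧ dzₙ), with point counting in place of
Stokes' theorem. The double numbers split as ℝ × ℝ through x + τy ↦ (x + y, x − y), so Φ is half the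
sum of the pullbacks of the volume form of ℝⁿ under `sumMap` and `diffMap`.

Pointwise, let X and Y be the matrices of real and imaginary parts of a frame of a positive
space-like plane, chosen so that det (X + Y) and det (X − Y) are positive. Then (X + Y)(X − Y)ᵀ is
the Gram matrix XXᵀ − YYᵀ plus the skew matrix YXᵀ − XYᵀ. The Ostrowski–Taussky inequality
`det_le_det_add_skew` and AM–GM bound the metric volume by Φ. Equality forces the skew part to
vanish and the two determinants to agree; after normalising the frame this is membership in SUₙ(D).
Hence vol N ≤ ∫_N Φ, with equality exactly for split SLAG N by continuity of the densities, and vol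
M = ∫_M Φ.

Globally, both maps restrict to orientation-preserving local embeddings of M and of N, so by the
area formula ∫ Φ is obtained by integrating the number of points in their fibres. By
`ncard_fiber_eq` these numbers are the same for M and N: their difference is locally constant in y,
since near a common boundary point the two images are regions with the same edge and, thanks to the
boundary orientation, on the same side of it; and it vanishes off the compact images. Hence ∫_M Φ =
∫_N Φ. -/

namespace SplitSLAG

/-! ### Determinant inequalities -/

open Matrix in
/-- The determinant does not change sign along a segment of invertible matrices. -/
theorem det_add_pos_of_segment {n : ℕ} (A B : Matrix (Fin n) (Fin n) ℝ) (hA : 0 < A.det)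
    (h : ∀ s ∈ Set.Icc (0 : ℝ) 1, (A + s • B).det ≠ 0) : 0 < (A + B).det := by
  have hc : Continuous fun s : ℝ => (A + s • B).det := by fun_prop
  by_contra hneg
  have h1 : (A + (1 : ℝ) • B).det ≤ 0 := by simpa using not_lt.1 hneg
  have h0 : 0 ≤ (A + (0 : ℝ) • B).det := by simpa using hA.le
  obtain ⟨s, hs, hs0⟩ := intermediate_value_Icc' zero_le_one hc.continuousOn ⟨h1, h0⟩
  exact h s hs hs0

open Matrix in
-- In terms of the eigenvalues λᵢ ≥ 0 this is ∏ (1 + λᵢ) ≥ 1 + ∑ λᵢ.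
theorem one_add_trace_le_det_one_add {n : ℕ} {H : Matrix (Fin n) (Fin n) ℝ}
    (hH : H.PosSemidef) : 1 + H.trace ≤ (1 + H).det := by
  have h1 : (1 + H).det = ∏ i, (1 + hH.1.eigenvalues i) := by
    -- The characteristic polynomial at −1 is det (−(1 + H)); the factor (−1)ⁿ appears on both sides
    -- and cancels.
    have h2 := congrArg (Polynomial.eval (-1)) hH.1.charpoly_eq
    rw [Matrix.eval_charpoly, Polynomial.eval_prod] at h2
    have h3 : (Matrix.scalar (Fin n)) (-1 : ℝ) - H = -(1 + H) := by
      rw [map_neg, map_one]; abel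
    rw [h3, Matrix.det_neg] at h2
    have h4 : ∏ i, Polynomial.eval (-1) (Polynomial.X - Polynomial.C (hH.1.eigenvalues i : ℝ))
        = (-1) ^ Fintype.card (Fin n) * ∏ i, (1 + hH.1.eigenvalues i) := by
      rw [← Finset.card_univ, ← Finset.prod_const, ← Finset.prod_mul_distrib]
      refine Finset.prod_congr rfl fun i _ => ?_
      simp; ring
    have h5 := h2.trans h4
    exact mul_left_cancel₀ (pow_ne_zero _ (by norm_num)) h5
  rw [h1, hH.1.trace_eq_sum_eigenvalues]
  have h6 : ∀ s : Finset (Fin n), 1 + ∑ i ∈ s, hH.1.eigenvalues i ≤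
      ∏ i ∈ s, (1 + hH.1.eigenvalues i) := fun s => by
    induction s using Finset.induction_on with
    | empty => simp
    | insert i s hi ih =>
      rw [Finset.sum_insert hi, Finset.prod_insert hi]
      have h7 := hH.eigenvalues_nonneg i
      have h8 : 0 ≤ ∑ i ∈ s, hH.1.eigenvalues i :=
        Finset.sum_nonneg fun i _ => hH.eigenvalues_nonneg i
      nlinarith [mul_nonneg h7 h8]
  simpa using h6 Finset.univ

open Matrix in
theorem det_ne_zero_of_vecMul {n : ℕ} {A : Matrix (Fin n) (Fin n) ℝ}
    (h : ∀ x : Fin n → ℝ, x ≠ 0 → x ᵥ* A ≠ 0) : A.det ≠ 0 := by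
  intro h0
  obtain ⟨x, hx, hx0⟩ := Matrix.exists_vecMul_eq_zero_iff.2 h0
  exact h x hx hx0

open Matrix in
theorem dotProduct_vecMul_skew {n : ℕ} {K : Matrix (Fin n) (Fin n) ℝ} (hK : Kᵀ = -K)
    (x : Fin n → ℝ) : x ᵥ* K ⬝ᵥ x = 0 := by
  have h : x ᵥ* K ⬝ᵥ x = - (x ᵥ* K ⬝ᵥ x) := by
    conv_lhs => rw [dotProduct_comm, ← Matrix.mulVec_transpose, hK, neg_mulVec, dotProduct_neg,
      dotProduct_mulVec]
  linarith

open Matrix in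
-- Since (1 + K)ᵀ(1 + K) = 1 + KᵀK, the squared determinant is at least 1 + tr KᵀK, and tr KᵀK
-- vanishes only for K = 0. The sign is positive because 1 + sK stays invertible for s in [0, 1]:
-- x(1 + sK) · x = |x|².
theorem det_one_add_skew {n : ℕ} {K : Matrix (Fin n) (Fin n) ℝ} (hK : Kᵀ = -K) :
    1 ≤ (1 + K).det ∧ ((1 + K).det = 1 → K = 0) := by
  have hpos : 0 < (1 + K).det := by
    refine det_add_pos_of_segment 1 K (by simp) fun s _ => det_ne_zero_of_vecMul fun x hx h0 => ?_
    have h1 : x ᵥ* (1 + s • K) ⬝ᵥ x = x ⬝ᵥ x := by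
      rw [vecMul_add, vecMul_one, vecMul_smul, add_dotProduct, smul_dotProduct,
        dotProduct_vecMul_skew hK]
      simp
    rw [h0, zero_dotProduct] at h1
    exact hx (dotProduct_self_eq_zero.1 h1.symm)
  have hsq : (1 + K).det ^ 2 = (1 + Kᵀ * K).det := by
    have h1 : (1 + K)ᵀ.det = (1 + K).det := det_transpose _
    rw [sq]
    nth_rewrite 1 [← h1]
    rw [← det_mul, transpose_add, transpose_one, hK]
    congr 1
    noncomm_ring
  have hps : (Kᵀ * K).PosSemidef := by
    simpa [conjTranspose_eq_transpose_of_trivial] using posSemidef_conjTranspose_mul_self K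
  have htr := one_add_trace_le_det_one_add hps
  have htr0 := hps.trace_nonneg
  refine ⟨by nlinarith, fun h => ?_⟩
  rw [h] at hsq
  have h0 : (Kᴴ * K).trace = 0 := by
    rw [conjTranspose_eq_transpose_of_trivial]; linarith
  exact trace_conjTranspose_mul_self_eq_zero_iff.1 h0

open Matrix MatrixOrder in
theorem exists_symm_sqrt {n : ℕ} {S : Matrix (Fin n) (Fin n) ℝ} (hS : S.PosDef) :
    ∃ C : Matrix (Fin n) (Fin n) ℝ, 0 < C.det ∧ Cᵀ = C ∧ C * C = S := by
  have h0 : 0 ≤ S := hS.posSemidef.nonneg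
  have h1 : (CFC.sqrt S) * (CFC.sqrt S) = S := CFC.sqrt_mul_sqrt_self S h0
  have h2 : (CFC.sqrt S).PosSemidef := (CFC.sqrt_nonneg S).posSemidef
  refine ⟨CFC.sqrt S, lt_of_le_of_ne h2.det_nonneg fun h => ?_, ?_, h1⟩
  · have := hS.det_pos
    rw [← h1, det_mul, ← h] at this
    simp at this
  · rw [← conjTranspose_eq_transpose_of_trivial]; exact h2.1

open Matrix in
/-- The Ostrowski–Taussky inequality: a real matrix with positive definite symmetric part `S` has
determinant at least `det S`, with equality only for a symmetric matrix. -/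
theorem det_le_det_add_skew {n : ℕ} {S K : Matrix (Fin n) (Fin n) ℝ} (hS : S.PosDef)
    (hK : Kᵀ = -K) : S.det ≤ (S + K).det ∧ ((S + K).det = S.det → K = 0) := by
  obtain ⟨C, hC, hCt, rfl⟩ := exists_symm_sqrt hS
  have hu : IsUnit C.det := hC.ne'.isUnit
  have hK' : (C⁻¹ * K * C⁻¹)ᵀ = -(C⁻¹ * K * C⁻¹) := by
    rw [transpose_mul, transpose_mul, transpose_nonsing_inv, hCt, hK]
    noncomm_ring
  -- Congruence by the symmetric root C of S reduces to S = 1, with C⁻¹KC⁻¹ still skew.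
  have hfac : C * C + K = C * (1 + C⁻¹ * K * C⁻¹) * C := by
    rw [mul_add, add_mul, mul_one]
    congr 1
    rw [mul_assoc, mul_assoc, mul_assoc, nonsing_inv_mul _ hu, mul_one, ← mul_assoc,
      mul_nonsing_inv _ hu, one_mul]
  obtain ⟨h1, h2⟩ := det_one_add_skew hK'
  have hd : (C * C + K).det = C.det ^ 2 * (1 + C⁻¹ * K * C⁻¹).det := by
    rw [hfac, det_mul, det_mul]; ring
  rw [hd, det_mul]
  have hC2 : 0 < C.det ^ 2 := by positivity
  refine ⟨by nlinarith, fun h => ?_⟩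
  have h3 := h2 (mul_left_cancel₀ hC2.ne' (by rw [h]; ring))
  calc K = C * (C⁻¹ * K * C⁻¹) * C := by
        rw [mul_assoc, mul_assoc, mul_assoc, nonsing_inv_mul _ hu, mul_one, ← mul_assoc,
          mul_nonsing_inv _ hu, one_mul]
    _ = 0 := by rw [h3]; simp

/-! ### Frames, Gram matrices and the two null projections -/

/-- The matrix whose rows are the images under `L` of a family of vectors. -/
def frameMatrix {n : ℕ} (L : DSpace n →L[ℝ] (Fin n → ℝ)) (v : Fin n → DSpace n) :
    Matrix (Fin n) (Fin n) ℝ := Matrix.of fun i j => L (v i) j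

/-- The Gram matrix of a family of vectors of `Dⁿ`. -/
def gram {n : ℕ} (v : Fin n → DSpace n) : Matrix (Fin n) (Fin n) ℝ :=
  Matrix.of fun i j => splitInner (v i) (v j)

/-- The map `x + τ y ↦ x + y`. -/
def sumMap (n : ℕ) : DSpace n →L[ℝ] (Fin n → ℝ) :=
  ContinuousLinearMap.fst ℝ _ _ + ContinuousLinearMap.snd ℝ _ _

/-- The map `x + τ y ↦ x - y`. -/
def diffMap (n : ℕ) : DSpace n →L[ℝ] (Fin n → ℝ) :=
  ContinuousLinearMap.fst ℝ _ _ - ContinuousLinearMap.snd ℝ _ _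

/-- The family of linear combinations of `v` whose coefficients are the rows of `J`. -/
def combo {n : ℕ} (J : Matrix (Fin n) (Fin n) ℝ) (v : Fin n → DSpace n) : Fin n → DSpace n :=
  fun i => ∑ j, J i j • v j

variable {n : ℕ}

theorem frameMatrix_combo (L : DSpace n →L[ℝ] (Fin n → ℝ)) (J : Matrix (Fin n) (Fin n) ℝ)
    (v : Fin n → DSpace n) : frameMatrix L (combo J v) = J * frameMatrix L v := by
  ext i j
  simp [frameMatrix, combo, Matrix.mul_apply]

open Matrix in
theorem gram_eq (v : Fin n → DSpace n) :
    gram v = frameMatrix (.fst ℝ _ _) v * (frameMatrix (.fst ℝ _ _) v)ᵀ -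
      frameMatrix (.snd ℝ _ _) v * (frameMatrix (.snd ℝ _ _) v)ᵀ := by
  ext i j
  simp [frameMatrix, gram, Matrix.mul_apply, splitInner_eq]

open Matrix in
theorem gram_combo (J : Matrix (Fin n) (Fin n) ℝ) (v : Fin n → DSpace n) :
    gram (combo J v) = J * gram v * Jᵀ := by
  simp only [gram_eq, frameMatrix_combo, transpose_mul]
  noncomm_ring

theorem frameMatrix_sumMap (v : Fin n → DSpace n) :
    frameMatrix (sumMap n) v = frameMatrix (.fst ℝ _ _) v + frameMatrix (.snd ℝ _ _) v := by
  ext i j; simp [frameMatrix, sumMap]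

theorem frameMatrix_diffMap (v : Fin n → DSpace n) :
    frameMatrix (diffMap n) v = frameMatrix (.fst ℝ _ _) v - frameMatrix (.snd ℝ _ _) v := by
  ext i j; simp [frameMatrix, diffMap]

theorem re_sum (s : Finset (Fin n)) (f : Fin n → Double) :
    (∑ j ∈ s, f j).re = ∑ j ∈ s, (f j).re :=
  map_sum (AddMonoidHom.mk' (fun d : Double => d.re) (fun _ _ => rfl)) f s

theorem im_sum (s : Finset (Fin n)) (f : Fin n → Double) :
    (∑ j ∈ s, f j).im = ∑ j ∈ s, (f j).im :=
  map_sum (AddMonoidHom.mk' (fun d : Double => d.im) (fun _ _ => rfl)) f s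

/-- The ring homomorphism `x + τ y ↦ x + y`. -/
def sumHom : Double →+* ℝ where
  toFun z := z.re + z.im
  map_one' := by change (1 : ℝ) + 0 = 1; simp
  map_mul' x y := by simp; ring
  map_zero' := by simp
  map_add' x y := by simp; ring

/-- The ring homomorphism `x + τ y ↦ x - y`. -/
def diffHom : Double →+* ℝ where
  toFun z := z.re - z.im
  map_one' := by change (1 : ℝ) - 0 = 1; simp
  map_mul' x y := by simp; ring
  map_zero' := by simp
  map_add' x y := by simp; ring

theorem toDouble_stdVec (i : Fin n) : toDouble (stdVec i) = Pi.single i 1 := by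
  ext j <;>
  · by_cases h : j = i
    · subst h; simp [toDouble, stdVec]; rfl
    · simp [toDouble, stdVec, h]

/-! ### The pointwise inequality on oriented planes and its equality case -/

section Planes

variable {P : Submodule ℝ (DSpace n)} {o : Orientation ℝ P (Fin n)} {v w : Fin n → DSpace n}

theorem IsOrientedBasis.mem (h : IsOrientedBasis P o v) (i : Fin n) : v i ∈ P := by
  obtain ⟨b, hb, -⟩ := h
  rw [← hb]; exact (b i).2

theorem IsOrientedBasis.linearIndependent (h : IsOrientedBasis P o v) :
    LinearIndependent ℝ v := by
  obtain ⟨b, hb, -⟩ := h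
  have h1 := b.linearIndependent.map' P.subtype P.ker_subtype
  have h2 : v = P.subtype ∘ b := funext fun i => (hb i).symm
  rw [h2]; exact h1

theorem IsOrientedBasis.exists_combo (h : IsOrientedBasis P o v) (hw : ∀ i, w i ∈ P) :
    ∃ J, w = combo J v := by
  obtain ⟨b, hb, -⟩ := h
  refine ⟨fun i j => b.repr ⟨w i, hw i⟩ j, funext fun i => ?_⟩
  have h1 := congrArg (Subtype.val) (b.sum_repr ⟨w i, hw i⟩)
  simp only [AddSubmonoidClass.coe_finsetSum, SetLike.val_smul, hb] at h1
  exact h1.symm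

theorem IsOrientedBasis.combo_iff (h : IsOrientedBasis P o v) (J : Matrix (Fin n) (Fin n) ℝ) :
    IsOrientedBasis P o (combo J v) ↔ 0 < J.det := by
  obtain ⟨b, hb, rfl⟩ := h
  have key : ∀ u : Fin n → P, (∀ i, (u i : DSpace n) = combo J v i) → b.det u = J.det := by
    intro u hu
    rw [Module.Basis.det_apply, ← Matrix.det_transpose]
    congr 1
    ext i j
    have h1 : u i = ∑ j, J i j • b j := Subtype.ext (by simp [hu, combo, hb])
    rw [Matrix.transpose_apply, Module.Basis.toMatrix_apply, h1, b.repr_sum_self]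
  constructor
  · rintro ⟨b', hb', ho⟩
    rw [← key b' hb']
    exact (b.orientation_eq_iff_det_pos b').1 ho.symm
  · intro hJ
    let u : Fin n → P := fun i => ∑ j, J i j • b j
    have hu : ∀ i, (u i : DSpace n) = combo J v i := fun i => by simp [u, combo, hb]
    have hdet := key u hu
    obtain ⟨h1, h2⟩ := (Module.Basis.is_basis_iff_det b (v := u)).2
      (by rw [hdet]; exact hJ.ne'.isUnit)
    refine ⟨Module.Basis.mk h1 h2.ge, fun i => by rw [Module.Basis.mk_apply, hu], ?_⟩
    refine ((b.orientation_eq_iff_det_pos _).2 ?_).symm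
    rw [Module.Basis.coe_mk, hdet]
    exact hJ

open Matrix in
theorem det_ne_zero_of_linearIndependent_combo {J : Matrix (Fin n) (Fin n) ℝ}
    (h : LinearIndependent ℝ (combo J v)) : J.det ≠ 0 := by
  refine det_ne_zero_of_vecMul fun x hx h0 => hx ?_
  have h1 := Fintype.linearIndependent_iff.1 h x (by
    simp only [combo, Finset.smul_sum, smul_smul]
    rw [Finset.sum_comm]
    refine Finset.sum_eq_zero fun j _ => ?_
    rw [← Finset.sum_smul]
    have := congrFun h0 j
    simp only [vecMul, dotProduct, Pi.zero_apply] at this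
    rw [this, zero_smul])
  exact funext h1

/-- `L` maps the oriented plane `(P, o)` isomorphically onto the standard oriented `ℝⁿ`. -/
def IsPositiveOn (L : DSpace n →L[ℝ] (Fin n → ℝ)) (P : Submodule ℝ (DSpace n))
    (o : Orientation ℝ P (Fin n)) : Prop :=
  ∃ v, IsOrientedBasis P o v ∧ 0 < (frameMatrix L v).det

variable {L : DSpace n →L[ℝ] (Fin n → ℝ)}

/-- Replaces the orientation of a plane by the sign of a determinant in ℝⁿ; later orientation
arguments take place in ℝⁿ. -/
theorem IsPositiveOn.isOrientedBasis_iff (h : IsPositiveOn L P o) (hw : ∀ i, w i ∈ P) :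
    IsOrientedBasis P o w ↔ 0 < (frameMatrix L w).det := by
  obtain ⟨v, hv, hpos⟩ := h
  obtain ⟨J, rfl⟩ := hv.exists_combo hw
  rw [hv.combo_iff, frameMatrix_combo, Matrix.det_mul, mul_pos_iff_of_pos_right hpos]

theorem IsPositiveOn.det_ne_zero (h : IsPositiveOn L P o) (hw : ∀ i, w i ∈ P)
    (hli : LinearIndependent ℝ w) : (frameMatrix L w).det ≠ 0 := by
  obtain ⟨v, hv, hpos⟩ := h
  obtain ⟨J, rfl⟩ := hv.exists_combo hw
  rw [frameMatrix_combo, Matrix.det_mul]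
  exact mul_ne_zero (det_ne_zero_of_linearIndependent_combo hli) hpos.ne'

/-- On a plane mapped isomorphically by `L`, the metric volume of a frame is proportional to the
volume of its image. -/
theorem IsPositiveOn.exists_density (h : IsPositiveOn L P o) :
    ∃ r : ℝ, ∀ w : Fin n → DSpace n, (∀ i, w i ∈ P) →
      √(gram w).det = |(frameMatrix L w).det| * r := by
  obtain ⟨v, hv, hpos⟩ := h
  refine ⟨√(gram v).det / (frameMatrix L v).det, fun w hw => ?_⟩
  obtain ⟨J, rfl⟩ := hv.exists_combo hw
  rw [frameMatrix_combo, gram_combo, Matrix.det_mul, Matrix.det_mul, Matrix.det_mul,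
    Matrix.det_transpose, mul_right_comm, Real.sqrt_mul (mul_self_nonneg _), Real.sqrt_mul_self_eq_abs,
    abs_mul, abs_of_pos hpos]
  field_simp

/-- Metric volume and both projected volumes scale by |det J|, so they need comparing on only one
frame of each plane. -/
theorem calibration_combo (J : Matrix (Fin n) (Fin n) ℝ) (v : Fin n → DSpace n) :
    √(gram (combo J v)).det = |J.det| * √(gram v).det ∧
    ∀ L, |(frameMatrix L (combo J v)).det| = |J.det| * |(frameMatrix L v).det| := by
  refine ⟨?_, fun L => by rw [frameMatrix_combo, Matrix.det_mul, abs_mul]⟩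
  rw [gram_combo, Matrix.det_mul, Matrix.det_mul, Matrix.det_transpose, mul_right_comm,
    Real.sqrt_mul (mul_self_nonneg _), Real.sqrt_mul_self_eq_abs]

open Matrix in
theorem vecMul_gram_dotProduct (v : Fin n → DSpace n) (x : Fin n → ℝ) :
    x ⬝ᵥ (gram v *ᵥ x) =
      (x ᵥ* frameMatrix (.fst ℝ _ _) v) ⬝ᵥ (x ᵥ* frameMatrix (.fst ℝ _ _) v) -
      (x ᵥ* frameMatrix (.snd ℝ _ _) v) ⬝ᵥ (x ᵥ* frameMatrix (.snd ℝ _ _) v) := by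
  rw [gram_eq, sub_mulVec, dotProduct_sub]
  congr 1 <;>
  · rw [← mulVec_mulVec, mulVec_transpose, dotProduct_mulVec]

open Matrix in
theorem gram_posDef (hP : ∀ z ∈ P, z ≠ 0 → 0 < splitInner z z) (h : IsOrientedBasis P o v) :
    (gram v).PosDef := by
  refine Matrix.PosDef.of_dotProduct_mulVec_pos ?_ fun x hx => ?_
  · rw [IsHermitian, conjTranspose_eq_transpose_of_trivial, gram_eq, transpose_sub,
      transpose_mul, transpose_mul, transpose_transpose, transpose_transpose]
  · have h1 := hP (∑ i, x i • v i) (P.sum_mem fun i _ => P.smul_mem _ (h.mem i)) fun h0 =>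
      hx (funext (Fintype.linearIndependent_iff.1 h.linearIndependent x h0))
    rw [star_trivial, vecMul_gram_dotProduct]
    refine h1.trans_eq ?_
    rw [splitInner_eq, Finset.sum_sub_distrib]
    simp [vecMul, dotProduct, frameMatrix, Prod.fst_sum, Prod.snd_sum]

open Matrix in
-- If x(X + sY) = 0, then xX = −s xY and the metric at the combination with coefficients x is (s² −
-- 1)|xY|² ≤ 0, against positivity. Hence det (X ± Y) has the sign of det X.
theorem det_fst_add_smul_snd_ne_zero (hg : (gram v).PosDef) {s : ℝ} (hs : |s| ≤ 1) :
    (frameMatrix (.fst ℝ _ _) v + s • frameMatrix (.snd ℝ _ _) v).det ≠ 0 := by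
  refine det_ne_zero_of_vecMul fun x hx h0 => ?_
  have h1 := hg.dotProduct_mulVec_pos hx
  rw [star_trivial, vecMul_gram_dotProduct] at h1
  rw [vecMul_add, vecMul_smul] at h0
  rw [eq_neg_of_add_eq_zero_left h0, neg_dotProduct_neg, smul_dotProduct, dotProduct_smul,
    smul_eq_mul, smul_eq_mul, ← mul_assoc] at h1
  have h2 : 0 ≤ (x ᵥ* frameMatrix (.snd ℝ _ _) v) ⬝ᵥ (x ᵥ* frameMatrix (.snd ℝ _ _) v) :=
    dotProduct_self_star_nonneg (R := ℝ) _
  have h3 : s * s ≤ 1 := by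
    have := abs_mul_abs_self s
    nlinarith [abs_nonneg s]
  nlinarith

theorem det_sumMap_pos (hg : (gram v).PosDef) (h : 0 < (frameMatrix (.fst ℝ _ _) v).det) :
    0 < (frameMatrix (sumMap n) v).det := by
  rw [frameMatrix_sumMap]
  exact det_add_pos_of_segment _ _ h fun s hs =>
    det_fst_add_smul_snd_ne_zero hg (by rw [abs_of_nonneg hs.1]; exact hs.2)

theorem det_diffMap_pos (hg : (gram v).PosDef) (h : 0 < (frameMatrix (.fst ℝ _ _) v).det) :
    0 < (frameMatrix (diffMap n) v).det := by
  rw [frameMatrix_diffMap, sub_eq_add_neg]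
  refine det_add_pos_of_segment _ _ h fun s hs => ?_
  rw [smul_neg, ← neg_smul]
  exact det_fst_add_smul_snd_ne_zero hg (by rw [abs_neg, abs_of_nonneg hs.1]; exact hs.2)

open Matrix in
/-- The pointwise inequality behind the calibration argument, with its equality case. -/
theorem det_gram_le (hg : (gram v).PosDef) :
    (gram v).det ≤ (frameMatrix (sumMap n) v).det * (frameMatrix (diffMap n) v).det ∧
    ((frameMatrix (sumMap n) v).det * (frameMatrix (diffMap n) v).det = (gram v).det →
      frameMatrix (.snd ℝ _ _) v * (frameMatrix (.fst ℝ _ _) v)ᵀ =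
        frameMatrix (.fst ℝ _ _) v * (frameMatrix (.snd ℝ _ _) v)ᵀ) := by
  set X := frameMatrix (.fst ℝ _ _) v
  set Y := frameMatrix (.snd ℝ _ _) v
  have hK : (Y * Xᵀ - X * Yᵀ)ᵀ = -(Y * Xᵀ - X * Yᵀ) := by
    simp only [transpose_sub, transpose_mul, transpose_transpose]
    abel
  have h1 := det_le_det_add_skew hg hK
  -- The product of the two null projections has the Gram matrix as its symmetric part, which brings
  -- the statement into Ostrowski–Taussky form.
  have h2 : gram v + (Y * Xᵀ - X * Yᵀ) = (X + Y) * (X - Y)ᵀ := by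
    rw [gram_eq, transpose_sub]
    noncomm_ring
  rw [h2, det_mul, det_transpose] at h1
  rw [frameMatrix_sumMap, frameMatrix_diffMap]
  exact ⟨h1.1, fun h => sub_eq_zero.1 (h1.2 h)⟩

/-- In the graph frame X = 1, so positivity of the plane is det X > 0, and deforming X to X ± Y
preserves it. -/
theorem IsPositiveSpacelikePlane.exists_frame (h : IsPositiveSpacelikePlane P o) :
    ∃ v, IsOrientedBasis P o v ∧ (gram v).PosDef ∧ 0 < (frameMatrix (sumMap n) v).det ∧
      0 < (frameMatrix (diffMap n) v).det := by
  obtain ⟨hP, A, hA⟩ := h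
  have hg := gram_posDef hP hA
  have h1 : frameMatrix (.fst ℝ _ _)
      (fun i => ((Pi.single i 1, A.mulVec (Pi.single i 1)) : DSpace n)) = 1 := by
    ext i j
    simp [frameMatrix, Matrix.one_apply, Pi.single_apply, eq_comm]
  have h2 : 0 < (frameMatrix (.fst ℝ _ _)
      (fun i => ((Pi.single i 1, A.mulVec (Pi.single i 1)) : DSpace n))).det := by
    rw [h1]; simp
  exact ⟨_, hA, hg, det_sumMap_pos hg h2, det_diffMap_pos hg h2⟩

theorem IsPositiveSpacelikePlane.isPositiveOn_sumMap (h : IsPositiveSpacelikePlane P o) :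
    IsPositiveOn (sumMap n) P o := by
  obtain ⟨v, h1, -, h2, -⟩ := h.exists_frame
  exact ⟨v, h1, h2⟩

theorem IsPositiveSpacelikePlane.isPositiveOn_diffMap (h : IsPositiveSpacelikePlane P o) :
    IsPositiveOn (diffMap n) P o := by
  obtain ⟨v, h1, -, -, h2⟩ := h.exists_frame
  exact ⟨v, h1, h2⟩

/-- The absolute value of the calibration form on a frame, when both determinants have the same
sign. -/
noncomputable def calibration (v : Fin n → DSpace n) : ℝ :=
  (|(frameMatrix (sumMap n) v).det| + |(frameMatrix (diffMap n) v).det|) / 2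

theorem IsPositiveSpacelikePlane.sqrt_det_gram_le (h : IsPositiveSpacelikePlane P o)
    (hw : ∀ i, w i ∈ P) : √(gram w).det ≤ calibration w := by
  obtain ⟨v, hv, hg, ha, hb⟩ := h.exists_frame
  obtain ⟨J, rfl⟩ := hv.exists_combo hw
  rw [calibration, (calibration_combo J v).1, (calibration_combo J v).2,
    (calibration_combo J v).2, ← mul_add, mul_div_assoc, abs_of_pos ha, abs_of_pos hb]
  refine mul_le_mul_of_nonneg_left ?_ (abs_nonneg _)
  -- With a and b the two determinants, det G ≤ ab ≤ ((a + b)/2)².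
  refine Real.sqrt_le_iff.2 ⟨by positivity, (det_gram_le hg).1.trans ?_⟩
  nlinarith [sq_nonneg ((frameMatrix (sumMap n) v).det - (frameMatrix (diffMap n) v).det)]

open Matrix in
/-- A frame with unit Gram matrix, symmetric `X Yᵀ` and both determinants equal to one is the image
of the standard frame under an element of `SU_n(D)`. -/
theorem isSplitSLAGPlane_of_unit_frame (hv : IsOrientedBasis P o v) (hg : gram v = 1)
    (hs : frameMatrix (.snd ℝ _ _) v * (frameMatrix (.fst ℝ _ _) v)ᵀ =
        frameMatrix (.fst ℝ _ _) v * (frameMatrix (.snd ℝ _ _) v)ᵀ)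
    (ha : (frameMatrix (sumMap n) v).det = 1) (hb : (frameMatrix (diffMap n) v).det = 1) :
    IsSplitSLAGPlane P o := by
  let B : Matrix (Fin n) (Fin n) Double := Matrix.of fun i j => ⟨(v j).1 i, (v j).2 i⟩
  -- The columns of B are the frame vectors: the real part of B*B is the Gram matrix, and its
  -- imaginary part is the skew matrix that `hs` makes zero.
  have hunit : star B * B = 1 := by
    ext i k
    · have h1 := congrFun (congrFun hg i) k
      rw [gram, of_apply, splitInner_eq] at h1
      rw [mul_apply, re_sum]
      have h2 : ((1 : Matrix (Fin n) (Fin n) Double) i k).re = (1 : Matrix _ _ ℝ) i k := by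
        simp only [one_apply]; split_ifs <;> rfl
      rw [h2, ← h1]
      refine Finset.sum_congr rfl fun j _ => ?_
      simp [B, star_apply]
      ring
    · have h1 := congrFun (congrFun hs i) k
      simp only [mul_apply, frameMatrix, of_apply, transpose_apply,
        ContinuousLinearMap.coe_fst', ContinuousLinearMap.coe_snd'] at h1
      rw [mul_apply, im_sum]
      have h2 : ((1 : Matrix (Fin n) (Fin n) Double) i k).im = 0 := by
        simp only [one_apply]; split_ifs <;> rfl
      refine Eq.trans ?_ ((sub_eq_zero.2 h1.symm).trans h2.symm)
      rw [← Finset.sum_sub_distrib]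
      refine Finset.sum_congr rfl fun j _ => ?_
      simp [B, star_apply]
      ring
  -- A double number is determined by its images under the two ring homomorphisms to ℝ, and these
  -- commute with det.
  have hp : B.det.re + B.det.im = 1 := by
    have h1 : sumHom B.det = (sumHom.mapMatrix B).det := sumHom.map_det B
    have h2 : sumHom.mapMatrix B = (frameMatrix (sumMap n) v)ᵀ := by
      ext i j; simp [sumHom, B, frameMatrix, sumMap]
    rw [h2, det_transpose, ha] at h1
    exact h1
  have hq : B.det.re - B.det.im = 1 := by
    have h1 : diffHom B.det = (diffHom.mapMatrix B).det := diffHom.map_det B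
    have h2 : diffHom.mapMatrix B = (frameMatrix (diffMap n) v)ᵀ := by
      ext i j; simp [diffHom, B, frameMatrix, diffMap]
    rw [h2, det_transpose, hb] at h1
    exact h1
  refine ⟨B, mem_specialUnitaryGroup_iff.2 ⟨mem_unitaryGroup_iff'.2 hunit, ?_⟩, ?_⟩
  · ext
    · change _ = (1 : ℝ); linarith
    · change _ = (0 : ℝ); linarith
  · convert hv using 2 with i
    rw [toDouble_stdVec, mulVec_single_one]
    rfl

open Matrix in
theorem IsSplitSLAGPlane.exists_unit_frame (h : IsSplitSLAGPlane P o) :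
    ∃ v, IsOrientedBasis P o v ∧ gram v = 1 ∧ (frameMatrix (sumMap n) v).det = 1 ∧
      (frameMatrix (diffMap n) v).det = 1 := by
  obtain ⟨B, hB, hv⟩ := h
  obtain ⟨hunit, hdet⟩ := mem_specialUnitaryGroup_iff.1 hB
  replace hunit := mem_unitaryGroup_iff'.1 hunit
  have hcol : ∀ i, ofDouble (B.mulVec (toDouble (stdVec i))) =
      ((fun j => (B j i).re, fun j => (B j i).im) : DSpace n) := fun i => by
    rw [toDouble_stdVec, mulVec_single_one]
    rfl
  simp only [hcol] at hv
  refine ⟨_, hv, ?_, ?_, ?_⟩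
  · ext i k
    have h1 := congrArg QuadraticAlgebra.re (congrFun (congrFun hunit i) k)
    rw [mul_apply, re_sum] at h1
    have h2 : ((1 : Matrix (Fin n) (Fin n) Double) i k).re = (1 : Matrix _ _ ℝ) i k := by
      simp only [one_apply]; split_ifs <;> rfl
    rw [← h2, ← h1, gram, of_apply, splitInner_eq]
    refine Finset.sum_congr rfl fun j _ => ?_
    simp [star_apply]
    ring
  · have h1 : sumHom B.det = (sumHom.mapMatrix B).det := sumHom.map_det B
    rw [hdet, map_one] at h1
    refine Eq.trans ?_ h1.symm
    rw [← det_transpose]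
    congr 1
  · have h1 : diffHom B.det = (diffHom.mapMatrix B).det := diffHom.map_det B
    rw [hdet, map_one] at h1
    refine Eq.trans ?_ h1.symm
    rw [← det_transpose]
    congr 1

theorem IsSplitSLAGPlane.isPositiveOn_sumMap (h : IsSplitSLAGPlane P o) :
    IsPositiveOn (sumMap n) P o := by
  obtain ⟨v, h1, -, h2, -⟩ := h.exists_unit_frame
  exact ⟨v, h1, by rw [h2]; exact one_pos⟩

theorem IsSplitSLAGPlane.isPositiveOn_diffMap (h : IsSplitSLAGPlane P o) :
    IsPositiveOn (diffMap n) P o := by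
  obtain ⟨v, h1, -, -, h2⟩ := h.exists_unit_frame
  exact ⟨v, h1, by rw [h2]; exact one_pos⟩

theorem IsSplitSLAGPlane.sqrt_det_gram_eq (h : IsSplitSLAGPlane P o)
    (hw : ∀ i, w i ∈ P) : √(gram w).det = calibration w := by
  obtain ⟨v, hv, hg, ha, hb⟩ := h.exists_unit_frame
  obtain ⟨J, rfl⟩ := hv.exists_combo hw
  rw [calibration, (calibration_combo J v).1, (calibration_combo J v).2,
    (calibration_combo J v).2, ha, hb, hg]
  simp

open Matrix in
-- Equality in AM–GM gives a = b, and then equality in Ostrowski–Taussky makes XYᵀ symmetric.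
-- Applying C⁻¹, for C the symmetric root of the Gram matrix, yields a unit frame; det C = a turns
-- both determinants into 1.
theorem IsPositiveSpacelikePlane.isSplitSLAGPlane (h : IsPositiveSpacelikePlane P o)
    (hw : ∀ i, w i ∈ P) (hli : LinearIndependent ℝ w) (heq : √(gram w).det = calibration w) :
    IsSplitSLAGPlane P o := by
  obtain ⟨v, hv, hg, ha, hb⟩ := h.exists_frame
  obtain ⟨J, rfl⟩ := hv.exists_combo hw
  rw [calibration, (calibration_combo J v).1, (calibration_combo J v).2,
    (calibration_combo J v).2, ← mul_add, mul_div_assoc, abs_of_pos ha, abs_of_pos hb] at heq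
  replace heq := mul_left_cancel₀ (abs_ne_zero.2 (det_ne_zero_of_linearIndependent_combo hli)) heq
  have hle := det_gram_le hg
  set a := (frameMatrix (sumMap n) v).det with ha'
  set b := (frameMatrix (diffMap n) v).det with hb'
  have hsq : (gram v).det = ((a + b) / 2) ^ 2 := by
    rw [← heq, Real.sq_sqrt hg.det_pos.le]
  have hab : a = b := by
    have : (a - b) ^ 2 ≤ 0 := by nlinarith [hle.1]
    exact sub_eq_zero.1 (pow_eq_zero_iff two_ne_zero |>.1 (le_antisymm this (sq_nonneg _)))
  have hsymm := hle.2 (by rw [hsq, hab]; ring)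
  obtain ⟨C, hC, hCt, hCC⟩ := exists_symm_sqrt hg
  have hu : IsUnit C.det := hC.ne'.isUnit
  have hCa : C.det = a := by
    have h1 : C.det ^ 2 = a ^ 2 := by
      rw [sq, ← det_mul, hCC, hsq, hab]; ring
    exact (pow_left_inj₀ hC.le ha.le two_ne_zero).1 h1
  have hinv : C⁻¹.det * C.det = 1 := by rw [← det_mul, nonsing_inv_mul _ hu, det_one]
  have hinvpos : 0 < C⁻¹.det := pos_of_mul_pos_left (by rw [hinv]; exact one_pos) hC.le
  refine isSplitSLAGPlane_of_unit_frame ((hv.combo_iff C⁻¹).2 hinvpos) ?_ ?_ ?_ ?_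
  · rw [gram_combo, ← hCC, transpose_nonsing_inv, hCt, ← mul_assoc, nonsing_inv_mul _ hu, one_mul,
      mul_nonsing_inv _ hu]
  · simp only [frameMatrix_combo, transpose_mul]
    calc _ = C⁻¹ * (frameMatrix (.snd ℝ _ _) v * (frameMatrix (.fst ℝ _ _) v)ᵀ) * C⁻¹ᵀ := by
          noncomm_ring
      _ = _ := by rw [hsymm]; noncomm_ring
  · rw [frameMatrix_combo, det_mul, ← ha', ← hCa, hinv]
  · rw [frameMatrix_combo, det_mul, ← hb', ← hab, ← hCa, hinv]

end Planes

open Set Filter Topology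

/-! ### Tangent cones and charts -/

section TangentCone

/-- The derivative carries the tangent cone of S into that of its image, which is locally one point
and has only the zero tangent vector. -/
theorem apply_eq_zero_of_mem_tangentSpace {F : Type*} [NormedAddCommGroup F] [NormedSpace ℝ F]
    {S : Set (DSpace n)} {p v : DSpace n} {f : DSpace n → F} {f' : DSpace n →L[ℝ] F}
    (hf : HasFDerivAt f f' p) {O : Set (DSpace n)} (hO : O ∈ 𝓝 p)
    (hconst : ∀ z ∈ S ∩ O, f z = f p) (hv : v ∈ tangentSpace S p) : f' v = 0 := by
  suffices h : tangentSpace S p ≤ LinearMap.ker (f' : DSpace n →ₗ[ℝ] F) from h hv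
  refine Submodule.span_le.2 fun w hw => ?_
  rw [← tangentConeAt_inter_nhds hO] at hw
  have h1 := (hf.hasFDerivWithinAt (s := S ∩ O)).mapsTo_tangent_cone hw
  have h2 : f '' (S ∩ O) ⊆ {f p} := by
    rintro _ ⟨z, hz, rfl⟩
    exact hconst z hz
  have h3 : ¬ AccPt (f p) (𝓟 {f p}) := by
    rw [accPt_principal_iff_clusterPt, sdiff_self]
    simp [ClusterPt]
  exact tangentConeAt_subset_zero h3 (tangentConeAt_mono h2 h1)

theorem tangentSpace_mono {S T : Set (DSpace n)} (h : S ⊆ T) (p : DSpace n) :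
    tangentSpace S p ≤ tangentSpace T p :=
  Submodule.span_mono (tangentConeAt_mono h)

end TangentCone

namespace HalfSpaceChart

variable [NeZero n] {M : Set (DSpace n)} (c : HalfSpaceChart M)

/-- The parametrization of `M` by a chart. -/
def param (t : Fin n → ℝ) : DSpace n := c.φ.symm (t, 0)

/-- The set of all `t` for which `(t, 0)` lies in the target of a chart. -/
def params : Set (Fin n → ℝ) := {t | (t, 0) ∈ c.φ.target}

theorem isOpen_params : IsOpen c.params :=
  c.φ.open_target.preimage (by fun_prop : Continuous fun t : Fin n → ℝ => (t, (0 : Fin n → ℝ)))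

variable {c}

theorem param_mem_source {t : Fin n → ℝ} (ht : t ∈ c.params) : c.param t ∈ c.φ.source :=
  c.φ.map_target ht

theorem φ_param {t : Fin n → ℝ} (ht : t ∈ c.params) : c.φ (c.param t) = (t, 0) :=
  c.φ.right_inv ht

theorem param_mem_iff {t : Fin n → ℝ} (ht : t ∈ c.params) : c.param t ∈ M ↔ 0 ≤ t 0 := by
  rw [c.mem_iff _ (param_mem_source ht), φ_param ht]
  simp

theorem φ_eq {p : DSpace n} (hp : p ∈ M) (hs : p ∈ c.φ.source) : c.φ p = ((c.φ p).1, 0) :=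
  Prod.ext rfl ((c.mem_iff p hs).1 hp).2

theorem coord_mem_params {p : DSpace n} (hp : p ∈ M) (hs : p ∈ c.φ.source) :
    (c.φ p).1 ∈ c.params := by
  change ((c.φ p).1, 0) ∈ c.φ.target
  rw [← φ_eq hp hs]
  exact c.φ.map_source hs

theorem coord_mem_dom {p : DSpace n} (hp : p ∈ M) (hs : p ∈ c.φ.source) :
    (c.φ p).1 ∈ c.dom :=
  ⟨coord_mem_params hp hs, ((c.mem_iff p hs).1 hp).1⟩

theorem param_coord {p : DSpace n} (hp : p ∈ M) (hs : p ∈ c.φ.source) :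
    c.param (c.φ p).1 = p := by
  rw [param, ← φ_eq hp hs]
  exact c.φ.left_inv hs

theorem hasStrictFDerivAt_symm {x : DSpace n} (hx : x ∈ c.φ.target) :
    HasStrictFDerivAt c.φ.symm (fderiv ℝ c.φ.symm x) x :=
  ((c.contDiffOn_symm.contDiffAt (c.φ.open_target.mem_nhds hx))).hasStrictFDerivAt one_ne_zero

theorem hasStrictFDerivAt {p : DSpace n} (hp : p ∈ c.φ.source) :
    HasStrictFDerivAt c.φ (fderiv ℝ c.φ p) p :=
  ((c.contDiffOn.contDiffAt (c.φ.open_source.mem_nhds hp))).hasStrictFDerivAt one_ne_zero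

variable (c) in
/-- The derivative of the parametrization of a chart. -/
noncomputable def paramDeriv (t : Fin n → ℝ) : (Fin n → ℝ) →L[ℝ] DSpace n :=
  (fderiv ℝ c.φ.symm (t, 0)).comp (.inl ℝ _ _)

theorem hasStrictFDerivAt_param {t : Fin n → ℝ} (ht : t ∈ c.params) :
    HasStrictFDerivAt c.param (c.paramDeriv t) t :=
  HasStrictFDerivAt.comp (g := c.φ.symm) (f := fun t => (t, (0 : Fin n → ℝ))) t
    (hasStrictFDerivAt_symm ht) ((hasStrictFDerivAt_id t).prodMk (hasStrictFDerivAt_const _ t))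

theorem continuousOn_param : ContinuousOn c.param c.params := fun _ ht =>
  (hasStrictFDerivAt_param ht).continuousAt.continuousWithinAt

theorem paramDeriv_single (t : Fin n → ℝ) (i : Fin n) :
    c.paramDeriv t (Pi.single i 1) = c.frame t i := rfl

theorem paramDeriv_apply (t v : Fin n → ℝ) : c.paramDeriv t v = ∑ i, v i • c.frame t i := by
  conv_lhs => rw [← Finset.univ_sum_single v]
  rw [map_sum]
  refine Finset.sum_congr rfl fun i _ => ?_
  rw [← paramDeriv_single, ← map_smul, ← Pi.single_smul, smul_eq_mul, mul_one]

theorem fderiv_symm_fderiv {p : DSpace n} (hs : p ∈ c.φ.source) (v : DSpace n) :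
    fderiv ℝ c.φ.symm (c.φ p) (fderiv ℝ c.φ p v) = v := by
  have h1 : HasFDerivAt (c.φ.symm ∘ c.φ) ((fderiv ℝ c.φ.symm (c.φ p)).comp (fderiv ℝ c.φ p)) p :=
    (hasStrictFDerivAt_symm (c.φ.map_source hs)).hasFDerivAt.comp p
      (hasStrictFDerivAt hs).hasFDerivAt
  have h2 : (c.φ.symm ∘ c.φ) =ᶠ[𝓝 p] id := by
    filter_upwards [c.φ.open_source.mem_nhds hs] with z hz using c.φ.left_inv hz
  have h3 := (h1.congr_of_eventuallyEq h2.symm).unique (hasFDerivAt_id p)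
  exact congrArg (fun f : DSpace n →L[ℝ] DSpace n => f v) h3

theorem fderiv_fderiv_symm {x : DSpace n} (hx : x ∈ c.φ.target) (v : DSpace n) :
    fderiv ℝ c.φ (c.φ.symm x) (fderiv ℝ c.φ.symm x v) = v := by
  have hs := c.φ.map_target hx
  have h1 : HasFDerivAt (c.φ ∘ c.φ.symm)
      ((fderiv ℝ c.φ (c.φ.symm x)).comp (fderiv ℝ c.φ.symm x)) x :=
    (hasStrictFDerivAt hs).hasFDerivAt.comp x (hasStrictFDerivAt_symm hx).hasFDerivAt
  have h2 : (c.φ ∘ c.φ.symm) =ᶠ[𝓝 x] id := by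
    filter_upwards [c.φ.open_target.mem_nhds hx] with z hz using c.φ.right_inv hz
  have h3 := (h1.congr_of_eventuallyEq h2.symm).unique (hasFDerivAt_id x)
  exact congrArg (fun f : DSpace n →L[ℝ] DSpace n => f v) h3

theorem fderiv_paramDeriv {t : Fin n → ℝ} (ht : t ∈ c.params) (v : Fin n → ℝ) :
    fderiv ℝ c.φ (c.param t) (c.paramDeriv t v) = (v, 0) :=
  fderiv_fderiv_symm ht (v, 0)

theorem linearIndependent_frame {t : Fin n → ℝ} (ht : t ∈ c.params) :
    LinearIndependent ℝ (c.frame t) := by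
  refine Fintype.linearIndependent_iff.2 fun g hg i => ?_
  rw [← paramDeriv_apply] at hg
  have h1 := fderiv_paramDeriv ht g
  rw [hg, map_zero] at h1
  exact congrFun (congrArg Prod.fst h1).symm i

/-- A short segment from t in direction v has a positive multiple of v in its tangent cone, and the
derivative carries this into the cone of S. Only r ≥ 0 is needed, so the lemma also applies at
boundary points. -/
theorem paramDeriv_mem_tangentSpace {S : Set (DSpace n)} {t v : Fin n → ℝ} (ht : t ∈ c.params)
    (h : ∀ r : ℝ, 0 ≤ r → t + r • v ∈ c.params → c.param (t + r • v) ∈ S) :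
    c.paramDeriv t v ∈ tangentSpace S (c.param t) := by
  have hcont : Tendsto (fun r : ℝ => t + r • v) (𝓝 0) (𝓝 t) := by
    have : Continuous fun r : ℝ => t + r • v := by fun_prop
    simpa using this.tendsto 0
  obtain ⟨ε, hε, hball⟩ := Metric.eventually_nhds_iff.1
    (hcont.eventually (c.isOpen_params.mem_nhds ht))
  have hseg : ∀ z ∈ segment ℝ t (t + (ε / 2) • v), c.param z ∈ S := by
    intro z hz
    rw [segment_eq_image'] at hz
    obtain ⟨θ, hθ, rfl⟩ := hz
    have h1 : t + θ • (t + (ε / 2) • v - t) = t + (θ * (ε / 2)) • v := by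
      rw [add_sub_cancel_left, smul_smul]
    simp only [h1]
    have h2 : 0 ≤ θ * (ε / 2) := mul_nonneg hθ.1 (by positivity)
    refine h _ h2 (hball ?_)
    rw [Real.dist_eq, sub_zero, abs_of_nonneg h2]
    nlinarith [hθ.2]
  have h1 : (t + (ε / 2) • v) - t ∈ tangentConeAt ℝ (segment ℝ t (t + (ε / 2) • v)) t :=
    mem_tangentConeAt_of_segment_subset subset_rfl
  have h2 := (hasStrictFDerivAt_param ht).hasFDerivAt.hasFDerivWithinAt.mapsTo_tangent_cone h1
  have h3 : c.param '' segment ℝ t (t + (ε / 2) • v) ⊆ S := by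
    rintro _ ⟨z, hz, rfl⟩
    exact hseg z hz
  have h4 : c.paramDeriv t ((t + (ε / 2) • v) - t) ∈ tangentSpace S (c.param t) :=
    Submodule.subset_span (tangentConeAt_mono h3 h2)
  rw [add_sub_cancel_left, map_smul] at h4
  exact (Submodule.smul_mem_iff _ (by positivity : ε / 2 ≠ 0)).1 h4

theorem frame_mem_tangentSpace {t : Fin n → ℝ} (ht : t ∈ c.dom) (i : Fin n) :
    c.frame t i ∈ tangentSpace M (c.param t) := by
  rw [← paramDeriv_single]
  refine paramDeriv_mem_tangentSpace ht.1 fun r hr hmem => (param_mem_iff hmem).2 ?_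
  have h1 : (0 : ℝ) ≤ (Pi.single i 1 : Fin n → ℝ) 0 := by
    rw [Pi.single_apply]; split_ifs <;> norm_num
  simpa using add_nonneg ht.2 (mul_nonneg hr h1)

theorem fderiv_snd_eq_zero {p v : DSpace n} (hp : p ∈ M) (hs : p ∈ c.φ.source)
    (hv : v ∈ tangentSpace M p) : (fderiv ℝ c.φ p v).2 = 0 := by
  have h1 : HasFDerivAt (fun z => (c.φ z).2)
      ((ContinuousLinearMap.snd ℝ _ _).comp (fderiv ℝ c.φ p)) p :=
    (hasFDerivAt_snd).comp p (hasStrictFDerivAt hs).hasFDerivAt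
  refine apply_eq_zero_of_mem_tangentSpace h1 (c.φ.open_source.mem_nhds hs) (fun z hz => ?_) hv
  rw [φ_eq hz.1 hz.2, φ_eq hp hs]

/-- Tangent vectors have no transverse component in the chart, so they are recovered from their
first n coordinates. -/
theorem paramDeriv_fderiv {p v : DSpace n} (hp : p ∈ M) (hs : p ∈ c.φ.source)
    (hv : v ∈ tangentSpace M p) : c.paramDeriv (c.φ p).1 (fderiv ℝ c.φ p v).1 = v := by
  have h1 := fderiv_symm_fderiv hs v
  rw [φ_eq hp hs] at h1
  have h2 : fderiv ℝ c.φ p v = ((fderiv ℝ c.φ p v).1, 0) :=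
    Prod.ext rfl (fderiv_snd_eq_zero hp hs hv)
  rw [h2] at h1
  exact h1

/-- The part of the domain of a chart which lies over an open set of parameters. -/
def tube (c : HalfSpaceChart M) (s : Set (Fin n → ℝ)) : Set (DSpace n) :=
  c.φ.source ∩ c.φ ⁻¹' (Prod.fst ⁻¹' s)

theorem isOpen_tube {s : Set (Fin n → ℝ)} (hs : IsOpen s) : IsOpen (c.tube s) :=
  c.φ.isOpen_inter_preimage (hs.preimage continuous_fst)

theorem continuousOn_frame (i : Fin n) : ContinuousOn (fun t => c.frame t i) c.params := by
  have h1 : ContinuousOn (fderiv ℝ c.φ.symm) c.φ.target :=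
    c.contDiffOn_symm.continuousOn_fderiv_of_isOpen c.φ.open_target le_rfl
  have h2 : ContinuousOn (fun t : Fin n → ℝ => fderiv ℝ c.φ.symm (t, 0)) c.params :=
    h1.comp (by fun_prop) fun t ht => ht
  exact h2.clm_apply continuousOn_const

theorem continuousOn_frameMatrix (L : DSpace n →L[ℝ] (Fin n → ℝ)) :
    ContinuousOn (fun t => frameMatrix L (c.frame t)) c.params := by
  refine continuousOn_pi.2 fun i => continuousOn_pi.2 fun j => ?_
  have h1 : Continuous fun z : DSpace n => L z j := by fun_prop
  exact h1.comp_continuousOn (continuousOn_frame i)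

end HalfSpaceChart

/-! ### Local inverses of a positive projection and chart independence of the boundary -/

variable [NeZero n]

namespace OrientedSubmanifold

/-- `L` maps all oriented tangent planes of `M` isomorphically onto the oriented `ℝⁿ`. -/
def IsPositiveFor (M : OrientedSubmanifold n) (L : DSpace n →L[ℝ] (Fin n → ℝ)) : Prop :=
  ∀ p : M.carrier, IsPositiveOn L (tangentSpace M.carrier (p : DSpace n)) (M.orientation p)

variable {M : OrientedSubmanifold n} {L : DSpace n →L[ℝ] (Fin n → ℝ)}

theorem IsPositiveFor.det_frame_ne_zero (hL : M.IsPositiveFor L) (c : HalfSpaceChart M.carrier)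
    {t : Fin n → ℝ} (ht : t ∈ c.dom) : (frameMatrix L (c.frame t)).det ≠ 0 :=
  (hL ⟨c.param t, (HalfSpaceChart.param_mem_iff ht.1).2 ht.2⟩).det_ne_zero
    (fun i => HalfSpaceChart.frame_mem_tangentSpace ht i)
    (HalfSpaceChart.linearIndependent_frame ht.1)

end OrientedSubmanifold

open HalfSpaceChart

theorem det_comp_paramDeriv {S : Set (DSpace n)} (L : DSpace n →L[ℝ] (Fin n → ℝ))
    (c : HalfSpaceChart S) (t : Fin n → ℝ) :
    (L.comp (c.paramDeriv t)).det = (frameMatrix L (c.frame t)).det := by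
  rw [ContinuousLinearMap.det, ← LinearMap.det_toMatrix', ← Matrix.det_transpose]
  congr 1

/-- A local inverse of the restriction of `L` to a submanifold, read in a chart. -/
structure LocalInverse {S : Set (DSpace n)} (L : DSpace n →L[ℝ] (Fin n → ℝ))
    (c : HalfSpaceChart S) (p : DSpace n) where
  e : OpenPartialHomeomorph (Fin n → ℝ) (Fin n → ℝ)
  deriv : (Fin n → ℝ) →L[ℝ] (Fin n → ℝ)
  coord_mem : (c.φ p).1 ∈ e.source
  source_subset : e.source ⊆ c.params
  coe_eq : ∀ t, e t = L (c.param t)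
  hasFDerivAt : HasFDerivAt e.symm deriv (L p)
  deriv_apply : ∀ v ∈ tangentSpace S p, deriv (L v) = (fderiv ℝ c.φ p v).1

/-- The inverse function theorem is applied to L ∘ `c.param` on all of `c.params`, including t₀ < 0.
Thus even at a boundary point the inverse lives on a full neighbourhood of L p, and M is cut out by
the sign of its coordinate 0. -/
theorem OrientedSubmanifold.IsPositiveFor.exists_localInverse {M : OrientedSubmanifold n}
    {L : DSpace n →L[ℝ] (Fin n → ℝ)} (hL : M.IsPositiveFor L) (c : HalfSpaceChart M.carrier)
    {p : DSpace n} (hp : p ∈ M.carrier) (hs : p ∈ c.φ.source) : Nonempty (LocalInverse L c p) := by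
  set t := (c.φ p).1 with ht
  have htd : t ∈ c.dom := coord_mem_dom hp hs
  have hparam : c.param t = p := param_coord hp hs
  have hdet : (L.comp (c.paramDeriv t)).det ≠ 0 := by
    rw [det_comp_paramDeriv]; exact hL.det_frame_ne_zero c htd
  let F' := (L.comp (c.paramDeriv t)).toContinuousLinearEquivOfDetNeZero hdet
  have hF : HasStrictFDerivAt (fun t => L (c.param t)) (F' : (Fin n → ℝ) →L[ℝ] (Fin n → ℝ)) t :=
    L.hasStrictFDerivAt.comp t (hasStrictFDerivAt_param htd.1)
  let e := (hF.toOpenPartialHomeomorph _).restrOpen c.params c.isOpen_params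
  have hte : t ∈ e.source := ⟨hF.mem_toOpenPartialHomeomorph_source, htd.1⟩
  have hcoe : ∀ t, e t = L (c.param t) := fun t => rfl
  have het : e t = L p := by rw [hcoe, hparam]
  have hsymm : e.symm (L p) = t := by rw [← het]; exact e.left_inv hte
  refine ⟨⟨e, F'.symm, hte, fun t h => h.2, hcoe, ?_, fun v hv => ?_⟩⟩
  · refine e.hasFDerivAt_symm (f' := F') ?_ ?_
    · rw [← het]; exact e.map_source hte
    · rw [hsymm]; exact hF.hasFDerivAt
  · rw [ContinuousLinearEquiv.coe_coe, ContinuousLinearEquiv.symm_apply_eq]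
    change L v = L (c.paramDeriv t (fderiv ℝ c.φ p v).1)
    rw [paramDeriv_fderiv hp hs hv]

namespace LocalInverse

variable {S : Set (DSpace n)} {L : DSpace n →L[ℝ] (Fin n → ℝ)} {c : HalfSpaceChart S}
  {p : DSpace n} (I : LocalInverse L c p)

/-- The neighbourhood of `p` on which `LocalInverse` inverts `L`. -/
def nhd : Set (DSpace n) := c.tube I.e.source

theorem isOpen_nhd : IsOpen I.nhd := isOpen_tube I.e.open_source

variable {I}

theorem mem_nhd (hs : p ∈ c.φ.source) : p ∈ I.nhd := ⟨hs, I.coord_mem⟩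

theorem apply_coord {z : DSpace n} (hz : z ∈ S) (hzI : z ∈ I.nhd) : I.e (c.φ z).1 = L z := by
  rw [I.coe_eq, param_coord hz hzI.1]

theorem symm_apply {z : DSpace n} (hz : z ∈ S) (hzI : z ∈ I.nhd) :
    I.e.symm (L z) = (c.φ z).1 := by
  rw [← apply_coord hz hzI]
  exact I.e.left_inv hzI.2

theorem mem_target {z : DSpace n} (hz : z ∈ S) (hzI : z ∈ I.nhd) : L z ∈ I.e.target := by
  rw [← apply_coord hz hzI]
  exact I.e.map_source hzI.2

theorem injOn : InjOn L (S ∩ I.nhd) := by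
  intro z hz w hw h
  have h1 := congrArg I.e.symm h
  rw [symm_apply hz.1 hz.2, symm_apply hw.1 hw.2] at h1
  rw [← param_coord hz.1 hz.2.1, ← param_coord hw.1 hw.2.1, h1]

theorem apply_param_symm {y : Fin n → ℝ} (hy : y ∈ I.e.target) :
    L (c.param (I.e.symm y)) = y := by
  rw [← I.coe_eq]; exact I.e.right_inv hy

theorem symm_mem_params {y : Fin n → ℝ} (hy : y ∈ I.e.target) : I.e.symm y ∈ c.params :=
  I.source_subset (I.e.map_target hy)

theorem tendsto_symm (hp : p ∈ S) (hs : p ∈ c.φ.source) :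
    Tendsto I.e.symm (𝓝 (L p)) (𝓝 (c.φ p).1) := by
  have h1 := I.hasFDerivAt.continuousAt.tendsto
  rwa [symm_apply hp (mem_nhd hs)] at h1

theorem eventually_mem_target (hp : p ∈ S) (hs : p ∈ c.φ.source) :
    ∀ᶠ y in 𝓝 (L p), y ∈ I.e.target :=
  I.e.open_target.mem_nhds (mem_target hp (mem_nhd hs))

theorem tendsto_param_symm (hp : p ∈ S) (hs : p ∈ c.φ.source) :
    Tendsto (fun y => c.param (I.e.symm y)) (𝓝 (L p)) (𝓝 p) := by
  have h1 := (hasStrictFDerivAt_param (c := c) (coord_mem_params hp hs)).continuousAt.tendsto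
  rw [param_coord hp hs] at h1
  exact h1.comp (tendsto_symm hp hs)

variable (I) in
/-- Near `p`, the fibres of `L` on `S` are described by the sign of a coordinate. -/
theorem eventually_mem_iff (hp : p ∈ S) (hs : p ∈ c.φ.source) {W : Set (DSpace n)}
    (hW : W ∈ 𝓝 p) (hWI : W ⊆ I.nhd) :
    ∀ᶠ y in 𝓝 (L p), (∃ z ∈ S ∩ W, L z = y) ↔ 0 ≤ I.e.symm y 0 := by
  filter_upwards [eventually_mem_target hp hs, (tendsto_param_symm (I := I) hp hs).eventually hW]
    with y hy hyW
  constructor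
  · rintro ⟨z, hz, rfl⟩
    rw [symm_apply hz.1 (hWI hz.2)]
    exact (coord_mem_dom hz.1 (hWI hz.2).1).2
  · intro h
    exact ⟨_, ⟨(param_mem_iff (symm_mem_params hy)).2 h, hyW⟩, apply_param_symm hy⟩

end LocalInverse

open LocalInverse

/-- The boundary does not depend on charts. -/
theorem OrientedSubmanifold.IsPositiveFor.mem_boundary_iff {M : OrientedSubmanifold n}
    {L : DSpace n →L[ℝ] (Fin n → ℝ)} (hL : M.IsPositiveFor L) (c : HalfSpaceChart M.carrier)
    {p : DSpace n} (hp : p ∈ M.carrier) (hs : p ∈ c.φ.source) :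
    p ∈ boundary M.carrier ↔ (c.φ p).1 0 = 0 := by
  refine ⟨?_, fun h => ⟨hp, c, hs, h⟩⟩
  rintro ⟨-, c', hs', h0⟩
  by_contra hne
  have hpos : 0 < (c.φ p).1 0 := lt_of_le_of_ne (coord_mem_dom hp hs).2 (Ne.symm hne)
  obtain ⟨I⟩ := hL.exists_localInverse c hp hs
  obtain ⟨I'⟩ := hL.exists_localInverse c' hp hs'
  have hW : I.nhd ∩ I'.nhd ∈ 𝓝 p :=
    inter_mem (I.isOpen_nhd.mem_nhds (mem_nhd hs)) (I'.isOpen_nhd.mem_nhds (mem_nhd hs'))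
  -- Both charts describe which y near L p are hit by M near p. If the first has t₀ > 0 at p, all
  -- are hit, so the second has t₀ ≥ 0 on a neighbourhood of a parameter with t₀ = 0; a small step
  -- along −e₀ contradicts this.
  have h1 := I.eventually_mem_iff hp hs hW inter_subset_left
  have h2 := I'.eventually_mem_iff hp hs' hW inter_subset_right
  have h3 : ∀ᶠ y in 𝓝 (L p), 0 < I.e.symm y 0 :=
    (tendsto_symm hp hs).eventually
      ((isOpen_lt continuous_const (continuous_apply 0)).mem_nhds hpos)
  have h4 : ∀ᶠ y in 𝓝 (L p), 0 ≤ I'.e.symm y 0 := by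
    filter_upwards [h1, h2, h3] with y h1 h2 h3 using h2.1 (h1.2 h3.le)
  have h5 : Tendsto I'.e (𝓝 (c'.φ p).1) (𝓝 (L p)) := by
    have := (I'.e.continuousAt I'.coord_mem).tendsto
    rwa [apply_coord hp (mem_nhd hs')] at this
  have h6 : ∀ᶠ t in 𝓝 (c'.φ p).1, 0 ≤ t 0 := by
    filter_upwards [h5.eventually h4, I'.e.open_source.mem_nhds I'.coord_mem] with t ht hts
    rwa [I'.e.left_inv hts] at ht
  have h7 : Tendsto (fun s : ℝ => (c'.φ p).1 - s • (Pi.single 0 1 : Fin n → ℝ)) (𝓝[>] 0)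
      (𝓝 (c'.φ p).1) := by
    have : Continuous fun s : ℝ => (c'.φ p).1 - s • (Pi.single 0 1 : Fin n → ℝ) := by fun_prop
    simpa using (this.tendsto 0).mono_left nhdsWithin_le_nhds
  obtain ⟨s, hs1, hs2⟩ := ((h7.eventually h6).and self_mem_nhdsWithin).exists
  simp only [Pi.sub_apply, Pi.smul_apply, Pi.single_eq_same, h0, smul_eq_mul, mul_one] at hs1
  have hs3 : 0 < s := hs2
  linarith

/-! ### Comparing the sign of a function with that of a linear form -/

section Sign

variable {E : Type*} [NormedAddCommGroup E] [NormedSpace ℝ E]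

theorem eventually_pos_of_hasFDerivAt {k : E → ℝ} {k' : E →L[ℝ] ℝ} {a u : E}
    (hk : HasFDerivAt k k' a) (ha : k a = 0) (hu : 0 < k' u) :
    ∀ᶠ s in 𝓝[>] (0 : ℝ), 0 < k (a + s • u) := by
  have h1 : HasDerivAt (fun s : ℝ => a + s • u) u 0 := by
    simpa using ((hasDerivAt_id (0 : ℝ)).smul_const u).const_add a
  have h2 : HasDerivAt (fun s : ℝ => k (a + s • u)) (k' u) 0 := by
    have hk' : HasFDerivAt k k' (a + (0 : ℝ) • u) := by simpa using hk
    exact hk'.comp_hasDerivAt 0 h1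
  have h3 := (hasDerivAt_iff_tendsto_slope.1 h2).eventually (lt_mem_nhds hu)
  have h4 : 𝓝[>] (0 : ℝ) ≤ 𝓝[≠] 0 := nhdsWithin_mono 0 fun x hx => ne_of_gt hx
  filter_upwards [h4 h3, self_mem_nhdsWithin] with s hs hs0
  simp only [slope, zero_smul, add_zero, ha, sub_zero, vsub_eq_sub, smul_eq_mul] at hs
  exact pos_of_mul_pos_right hs (inv_nonneg.2 (le_of_lt hs0))

/-- If `k` vanishes only where the linear form `ℓ` does, and both increase in some common
direction, then `k` is positive where `ℓ` is. -/
theorem eventually_pos_of_pos {k : E → ℝ} {k' ℓ : E →L[ℝ] ℝ} {a u : E}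
    (hk : HasFDerivAt k k' a) (ha : k a = 0) (hℓa : ℓ a = 0)
    (hcont : ∀ᶠ x in 𝓝 a, ContinuousAt k x) (hzero : ∀ᶠ x in 𝓝 a, k x = 0 → ℓ x = 0)
    (hu : 0 < k' u) (hℓu : 0 < ℓ u) : ∀ᶠ x in 𝓝 a, 0 < ℓ x → 0 < k x := by
  obtain ⟨ε, hε, hball⟩ := Metric.eventually_nhds_iff_ball.1 (hcont.and hzero)
  -- The half ball is convex and k has no zero on it, so one positive value, found along the ray in
  -- direction u, determines the sign throughout.
  have hpre : IsPreconnected (Metric.ball a ε ∩ {x | 0 < ℓ x}) :=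
    ((convex_ball a ε).inter (convex_halfSpace_gt ℓ.isLinear 0)).isPreconnected
  have hray : Tendsto (fun s : ℝ => a + s • u) (𝓝[>] 0) (𝓝 a) := by
    have : Continuous fun s : ℝ => a + s • u := by fun_prop
    simpa using (this.tendsto 0).mono_left nhdsWithin_le_nhds
  obtain ⟨s, ⟨hs1, hs2⟩, hs3⟩ := ((eventually_pos_of_hasFDerivAt hk ha hu).and
    (hray.eventually (Metric.ball_mem_nhds a hε)) |>.and self_mem_nhdsWithin).exists
  have hsℓ : 0 < ℓ (a + s • u) := by
    rw [map_add, hℓa, map_smul, smul_eq_mul, zero_add]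
    exact mul_pos hs3 hℓu
  filter_upwards [Metric.ball_mem_nhds a hε] with x hx hxℓ
  by_contra hneg
  obtain ⟨z, hz, hz0⟩ := hpre.intermediate_value (f := k) ⟨hx, hxℓ⟩ ⟨hs2, hsℓ⟩
    (fun z hz => (hball z hz.1).1.continuousWithinAt) ⟨not_lt.1 hneg, hs1.le⟩
  exact absurd ((hball z hz.1).2 hz0) (ne_of_gt hz.2)

/-- Two regions with the same edge and a common inward direction coincide near a: one half comes
from (k, ℓ, u), the other from (−k, −ℓ, −u). -/
theorem eventually_nonneg_iff {k : E → ℝ} {k' ℓ : E →L[ℝ] ℝ} {a u : E}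
    (hk : HasFDerivAt k k' a) (ha : k a = 0) (hℓa : ℓ a = 0)
    (hcont : ∀ᶠ x in 𝓝 a, ContinuousAt k x) (hzero : ∀ᶠ x in 𝓝 a, k x = 0 ↔ ℓ x = 0)
    (hu : 0 < k' u) (hℓu : 0 < ℓ u) : ∀ᶠ x in 𝓝 a, 0 ≤ ℓ x ↔ 0 ≤ k x := by
  have h1 := eventually_pos_of_pos hk ha hℓa hcont (hzero.mono fun x h => h.1) hu hℓu
  have h2 := eventually_pos_of_pos (k := fun x => -k x) (k' := -k') (ℓ := -ℓ) (u := -u)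
    hk.neg (by simp [ha]) (by simp [hℓa]) (hcont.mono fun x h => h.neg)
    (hzero.mono fun x h => by simpa using h.1) (by simpa using hu) (by simpa using hℓu)
  filter_upwards [h1, h2, hzero] with x h1 h2 h3
  simp only [_root_.neg_apply, Left.neg_pos_iff] at h2
  rcases lt_trichotomy (ℓ x) 0 with h | h | h
  · exact iff_of_false (not_le.2 h) (not_le.2 (h2 h))
  · exact iff_of_true h.ge (h3.2 h).ge
  · exact iff_of_true h.le (h1 h).le

end Sign

/-! ### Sides of a hyperplane read off from determinants -/

section Rows

/-- The matrix with first row `x` and the other rows given by `w`. -/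
def consRows (x : Fin n → ℝ) (w : {i : Fin n // i ≠ 0} → Fin n → ℝ) :
    Matrix (Fin n) (Fin n) ℝ := Matrix.of fun i => if h : i = 0 then x else w ⟨i, h⟩

variable {w : {i : Fin n // i ≠ 0} → Fin n → ℝ}

theorem consRows_eq_updateRow (x y : Fin n → ℝ) :
    consRows x w = (consRows y w).updateRow 0 x := by
  ext i j
  by_cases h : i = 0
  · subst h; simp [consRows]
  · simp [consRows, h]

theorem det_consRows_sub_smul (a b : ℝ) (x y : Fin n → ℝ) :
    (consRows (a • x - b • y) w).det = a * (consRows x w).det - b * (consRows y w).det := by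
  rw [consRows_eq_updateRow _ 0, sub_eq_add_neg, ← neg_smul, Matrix.det_updateRow_add,
    Matrix.det_updateRow_smul, Matrix.det_updateRow_smul, ← consRows_eq_updateRow,
    ← consRows_eq_updateRow]
  ring

open Matrix in
theorem det_consRows_eq_zero {g : (Fin n → ℝ) →ₗ[ℝ] ℝ} (hg : ∀ i, g (w i) = 0) (hg0 : g ≠ 0)
    {x : Fin n → ℝ} (hx : g x = 0) : (consRows x w).det = 0 := by
  refine Matrix.exists_mulVec_eq_zero_iff.1 ⟨fun j => g (Pi.single j 1), fun h => hg0 ?_, ?_⟩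
  · refine LinearMap.pi_ext' fun j => LinearMap.ext_ring ?_
    exact congrFun h j
  · have key : ∀ z : Fin n → ℝ, z ⬝ᵥ (fun j => g (Pi.single j 1)) = g z := fun z => by
      conv_rhs => rw [← Finset.univ_sum_single z, map_sum]
      refine Finset.sum_congr rfl fun j _ => ?_
      rw [← smul_eq_mul, ← map_smul, ← Pi.single_smul, smul_eq_mul, mul_one]
    ext i
    rw [mulVec, key]
    by_cases h : i = 0
    · subst h; simpa [consRows] using hx
    · simpa [consRows, h] using hg ⟨i, h⟩

/-- The vector g(x) y − g(y) x lies in ker g, as do the rows w, so its determinant with w vanishes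
and g(x) det(y, w) = g(y) det(x, w). Determinants of equal sign therefore put x and y on the same
side. -/
theorem apply_neg_of_det_consRows {g : (Fin n → ℝ) →ₗ[ℝ] ℝ} (hg : ∀ i, g (w i) = 0)
    {x y : Fin n → ℝ} (hx : g x < 0)
    (hdet : 0 < (consRows x w).det * (consRows y w).det) : g y < 0 := by
  have hg0 : g ≠ 0 := fun h => by simp [h] at hx
  have h1 : g (g x • y - g y • x) = 0 := by simp; ring
  have h2 := det_consRows_eq_zero hg hg0 h1
  rw [det_consRows_sub_smul] at h2
  by_contra hneg
  have h3 : g x * (consRows y w).det * (consRows x w).det =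
      g y * (consRows x w).det ^ 2 := by linear_combination (consRows x w).det * h2
  have h4 : 0 ≤ g y * (consRows x w).det ^ 2 := mul_nonneg (not_lt.1 hneg) (sq_nonneg _)
  nlinarith [mul_pos_of_neg_of_neg hx (neg_neg_of_pos hdet)]

open Matrix in
-- In a linear relation among the rows, g isolates the coefficient of x, and then G reads off the
-- others.
theorem det_consRows_ne_zero {g : (Fin n → ℝ) →ₗ[ℝ] ℝ} (hg : ∀ i, g (w i) = 0)
    {G : (Fin n → ℝ) →ₗ[ℝ] (Fin n → ℝ)} (hG : ∀ i, G (w i) = Pi.single i.1 1)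
    {x : Fin n → ℝ} (hx : g x ≠ 0) : (consRows x w).det ≠ 0 := by
  refine det_ne_zero_of_vecMul fun a ha h0 => ha ?_
  have key : ∑ i, a i • (if h : i = 0 then x else w ⟨i, h⟩) = 0 := by
    rw [← h0]
    ext j
    simp only [vecMul, dotProduct, consRows, of_apply, Finset.sum_apply, Pi.smul_apply,
      smul_eq_mul]
  have ha0 : a 0 = 0 := by
    have h1 := congrArg g key
    rw [map_sum, map_zero, Finset.sum_eq_single 0] at h1
    · simpa [hx] using h1
    · intro i _ hi
      simp [hi, hg]
    · simp
  have h2 := congrArg G key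
  rw [map_sum, map_zero] at h2
  have h3 : ∀ i, G (a i • (if h : i = 0 then x else w ⟨i, h⟩)) = Pi.single i (a i) := by
    intro i
    by_cases hi : i = 0
    · subst hi; simp [ha0]
    · rw [dif_neg hi, map_smul, hG ⟨i, hi⟩, ← Pi.single_smul, smul_eq_mul, mul_one]
  simp only [h3, Finset.univ_sum_single] at h2
  exact h2

theorem frameMatrix_cons (L : DSpace n →L[ℝ] (Fin n → ℝ)) (ν : DSpace n)
    (w : {i : Fin n // i ≠ 0} → DSpace n) :
    frameMatrix L (fun i => if h : i = 0 then ν else w ⟨i, h⟩) =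
      consRows (L ν) (fun i => L (w i)) := by
  ext i j
  by_cases h : i = 0 <;> simp [frameMatrix, consRows, h]

end Rows

open HalfSpaceChart LocalInverse OrientedSubmanifold

/-! ### Germs of the two images at a common boundary point -/

section Boundary

variable {M N : OrientedSubmanifold n} {L : DSpace n →L[ℝ] (Fin n → ℝ)}

theorem OrientedSubmanifold.IsPositiveFor.fderiv_boundary_eq_zero (hL : M.IsPositiveFor L)
    (c : HalfSpaceChart M.carrier) {p v : DSpace n} (hp : p ∈ boundary M.carrier)
    (hs : p ∈ c.φ.source) (hv : v ∈ tangentSpace (boundary M.carrier) p) :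
    (fderiv ℝ c.φ p v).1 0 = 0 := by
  have h1 : HasFDerivAt (fun z => (c.φ z).1 0)
      ((ContinuousLinearMap.proj 0).comp
        ((ContinuousLinearMap.fst ℝ _ _).comp (fderiv ℝ c.φ p))) p :=
    (ContinuousLinearMap.proj (R := ℝ) (φ := fun _ : Fin n => ℝ) 0).hasFDerivAt.comp p
      (HasFDerivAt.comp (g := Prod.fst) p hasFDerivAt_fst
        (HalfSpaceChart.hasStrictFDerivAt hs).hasFDerivAt)
  refine apply_eq_zero_of_mem_tangentSpace h1 (c.φ.open_source.mem_nhds hs) (fun z hz => ?_) hv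
  rw [(hL.mem_boundary_iff c hz.1.1 hz.2).1 hz.1, (hL.mem_boundary_iff c hp.1 hs).1 hp]

theorem frame_mem_tangentSpace_boundary (c : HalfSpaceChart M.carrier) {t : Fin n → ℝ}
    (ht : t ∈ c.dom) (h0 : t 0 = 0) {i : Fin n} (hi : i ≠ 0) :
    c.frame t i ∈ tangentSpace (boundary M.carrier) (c.param t) := by
  rw [← paramDeriv_single]
  refine paramDeriv_mem_tangentSpace ht.1 fun r _ hmem => ?_
  have h1 : (t + r • (Pi.single i 1 : Fin n → ℝ)) 0 = 0 := by
    simp [h0, hi.symm]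
  refine ⟨(param_mem_iff hmem).2 h1.ge, c, param_mem_source hmem, ?_⟩
  rw [φ_param hmem]
  exact h1

/-- The image under `L` of a vector tangent to the boundary has zero first coordinate. -/
theorem OrientedSubmanifold.IsPositiveFor.deriv_tangent_boundary (hL : M.IsPositiveFor L)
    {c : HalfSpaceChart M.carrier} {p : DSpace n} (I : LocalInverse L c p)
    (hp : p ∈ boundary M.carrier) (hs : p ∈ c.φ.source)
    {w : {i : Fin n // i ≠ 0} → DSpace n} (hw : ∀ i, w i ∈ tangentSpace (boundary M.carrier) p)
    (i) : I.deriv (L (w i)) 0 = 0 := by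
  rw [I.deriv_apply _ (tangentSpace_mono (fun z hz => hz.1) p (hw i))]
  exact hL.fderiv_boundary_eq_zero c hp hs (hw i)

theorem cons_mem_tangentSpace {p ν : DSpace n} (hν : ν ∈ tangentSpace M.carrier p)
    {w : {i : Fin n // i ≠ 0} → DSpace n} (hw : ∀ i, w i ∈ tangentSpace (boundary M.carrier) p)
    (i : Fin n) : (if h : i = 0 then ν else w ⟨i, h⟩) ∈ tangentSpace M.carrier p := by
  by_cases h : i = 0
  · simpa [h] using hν
  · simpa [h] using tangentSpace_mono (fun z hz => hz.1) p (hw ⟨i, h⟩)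

/-- An outward vector whose image has the sign determined by the boundary orientation. -/
theorem OrientedSubmanifold.IsPositiveFor.exists_outward (hL : M.IsPositiveFor L)
    {p : DSpace n} (hp : p ∈ boundary M.carrier)
    {w : {i : Fin n // i ≠ 0} → DSpace n} (hw : ∀ i, w i ∈ tangentSpace (boundary M.carrier) p)
    {G : (Fin n → ℝ) →ₗ[ℝ] (Fin n → ℝ)} (hG : ∀ i, G (L (w i)) = Pi.single i.1 1) :
    ∃ (c : HalfSpaceChart M.carrier) (ν : DSpace n), p ∈ c.φ.source ∧
      ν ∈ tangentSpace M.carrier p ∧ (fderiv ℝ c.φ p ν).1 0 < 0 ∧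
      (M.IsPositiveBoundaryFrame p w → 0 < (consRows (L ν) fun i => L (w i)).det) ∧
      (¬ M.IsPositiveBoundaryFrame p w → (consRows (L ν) fun i => L (w i)).det < 0) := by
  -- For a positive boundary frame the outward vector and chart come from the definition; otherwise
  -- −∂/∂t₀ in any boundary chart serves. The chart is part of the conclusion, so outwardness need
  -- not be compared between charts.
  by_cases hpos : M.IsPositiveBoundaryFrame p w
  · obtain ⟨-, ν, ⟨hν, c, hs, hneg⟩, hpM, hb⟩ := id hpos
    refine ⟨c, ν, hs, hν, hneg, fun _ => ?_, fun h => absurd hpos h⟩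
    rw [← frameMatrix_cons]
    exact ((hL ⟨p, hpM⟩).isOrientedBasis_iff (cons_mem_tangentSpace hν hw)).1 hb
  · obtain ⟨-, c, hs, h0⟩ := id hp
    have htd := coord_mem_dom hp.1 hs
    have hparam := param_coord hp.1 hs
    have hmem := frame_mem_tangentSpace htd 0
    rw [hparam] at hmem
    have hneg : (fderiv ℝ c.φ p (-c.frame (c.φ p).1 0)).1 0 < 0 := by
      have h1 := fderiv_paramDeriv htd.1 (Pi.single 0 1)
      rw [paramDeriv_single, hparam] at h1
      rw [map_neg, h1]
      simp
    have hν := neg_mem hmem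
    refine ⟨c, _, hs, hν, hneg, fun h => absurd h hpos, fun _ => ?_⟩
    obtain ⟨I⟩ := hL.exists_localInverse c hp.1 hs
    have hne := det_consRows_ne_zero (w := fun i => L (w i))
      (g := (LinearMap.proj 0).comp (I.deriv : (Fin n → ℝ) →ₗ[ℝ] (Fin n → ℝ)))
      (hL.deriv_tangent_boundary I hp hs hw) hG (x := L (-c.frame (c.φ p).1 0)) (by
        change I.deriv (L _) 0 ≠ 0
        rw [I.deriv_apply _ hν]
        exact hneg.ne)
    -- A positive determinant would make this very vector witness that w is a positive boundary
    -- frame.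
    refine lt_of_le_of_ne (not_lt.1 fun h => hpos ⟨hw, _, ⟨hν, c, hs, hneg⟩, hp.1, ?_⟩) hne
    rw [← frameMatrix_cons] at h
    exact ((hL ⟨p, hp.1⟩).isOrientedBasis_iff (cons_mem_tangentSpace hν hw)).2 h

/-- For w a coordinate frame of ∂M at p, equality of boundary orientations gives det(Lν, Lw) and
det(Lν', Lw) the same sign for suitable outward ν of M and ν' of N. So Lν and Lν' lie on one side of
the hyperplane tangent to the common edge, and −Lν' points inward for both. -/
theorem exists_common_direction (hM : M.IsPositiveFor L) (hN : N.IsPositiveFor L)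
    (h : M.SameOrientedBoundary N) {p : DSpace n} (hp : p ∈ boundary M.carrier) :
    ∃ (c : HalfSpaceChart M.carrier) (d : HalfSpaceChart N.carrier) (u : Fin n → ℝ)
      (I : LocalInverse L c p) (J : LocalInverse L d p),
      p ∈ c.φ.source ∧ p ∈ d.φ.source ∧ 0 < I.deriv u 0 ∧ 0 < J.deriv u 0 := by
  have hpN : p ∈ boundary N.carrier := h.1 ▸ hp
  obtain ⟨-, c₀, hs₀, h₀⟩ := id hp
  have htd := coord_mem_dom hp.1 hs₀
  have hparam := param_coord hp.1 hs₀
  obtain ⟨I₀⟩ := hM.exists_localInverse c₀ hp.1 hs₀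
  let w : {i : Fin n // i ≠ 0} → DSpace n := fun i => c₀.frame (c₀.φ p).1 i
  have hw : ∀ i, w i ∈ tangentSpace (boundary M.carrier) p := fun i => by
    have h1 := frame_mem_tangentSpace_boundary c₀ htd h₀ i.2
    rwa [hparam] at h1
  have hwN : ∀ i, w i ∈ tangentSpace (boundary N.carrier) p := h.1 ▸ hw
  have hG : ∀ i, (I₀.deriv : (Fin n → ℝ) →ₗ[ℝ] (Fin n → ℝ)) (L (w i)) = Pi.single i.1 1 := by
    intro i
    rw [ContinuousLinearMap.coe_coe,
      I₀.deriv_apply _ (tangentSpace_mono (fun z hz => hz.1) p (hw i))]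
    have h1 := fderiv_paramDeriv htd.1 (Pi.single i.1 1)
    rw [paramDeriv_single, hparam] at h1
    exact congrArg Prod.fst h1
  obtain ⟨c, ν, hs, hν, hneg, hdet₁, hdet₂⟩ := hM.exists_outward hp hw hG
  obtain ⟨d, ν', hs', hν', hneg', hdet₁', hdet₂'⟩ := hN.exists_outward hpN hwN hG
  obtain ⟨I⟩ := hM.exists_localInverse c hp.1 hs
  obtain ⟨J⟩ := hN.exists_localInverse d hpN.1 hs'
  have hprod : 0 < (consRows (L ν) fun i => L (w i)).det *
      (consRows (L ν') fun i => L (w i)).det := by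
    by_cases hpos : M.IsPositiveBoundaryFrame p w
    · exact mul_pos (hdet₁ hpos) (hdet₁' ((h.2 p hp w).1 hpos))
    · exact mul_pos_of_neg_of_neg (hdet₂ hpos) (hdet₂' fun h' => hpos ((h.2 p hp w).2 h'))
  have h1 := apply_neg_of_det_consRows (w := fun i => L (w i))
    (g := (LinearMap.proj 0).comp (I.deriv : (Fin n → ℝ) →ₗ[ℝ] (Fin n → ℝ)))
    (hM.deriv_tangent_boundary I hp hs hw) (x := L ν) (y := L ν') (by
      change I.deriv (L _) 0 < 0
      rw [I.deriv_apply _ hν]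
      exact hneg) hprod
  refine ⟨c, d, -L ν', I, J, hs, hs', ?_, ?_⟩
  · rw [map_neg]
    exact neg_pos.2 h1
  · rw [map_neg, J.deriv_apply _ hν']
    exact neg_pos.2 hneg'

/-- At a common boundary point, the images of `M` and `N` under `L` have the same germ. -/
theorem eventually_mem_image_iff (hM : M.IsPositiveFor L) (hN : N.IsPositiveFor L)
    (h : M.SameOrientedBoundary N) {p : DSpace n} (hp : p ∈ boundary M.carrier) :
    ∃ O ∈ 𝓝 p, InjOn L (M.carrier ∩ O) ∧ InjOn L (N.carrier ∩ O) ∧ ∀ W ∈ 𝓝 p, W ⊆ O →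
      ∀ᶠ y in 𝓝 (L p), (∃ z ∈ M.carrier ∩ W, L z = y) ↔ ∃ z ∈ N.carrier ∩ W, L z = y := by
  obtain ⟨c, d, u, I, J, hs, hs', hu, hu'⟩ := exists_common_direction hM hN h hp
  have hpN : p ∈ boundary N.carrier := h.1 ▸ hp
  have hO : I.nhd ∩ J.nhd ∈ 𝓝 p :=
    inter_mem (I.isOpen_nhd.mem_nhds (mem_nhd hs)) (J.isOpen_nhd.mem_nhds (mem_nhd hs'))
  refine ⟨_, hO, I.injOn.mono (inter_subset_inter_right _ inter_subset_left),
    J.injOn.mono (inter_subset_inter_right _ inter_subset_right), fun W hW hWO => ?_⟩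
  -- Both zero loci are the image of the common boundary near p.
  have hzero : ∀ᶠ y in 𝓝 (L p), J.e.symm y 0 = 0 ↔ I.e.symm y 0 = 0 := by
    filter_upwards [I.eventually_mem_target hp.1 hs, J.eventually_mem_target hpN.1 hs',
      (I.tendsto_param_symm hp.1 hs).eventually hO,
      (J.tendsto_param_symm hpN.1 hs').eventually hO] with y hI hJ hmI hmJ
    constructor
    · intro h0
      have h1 : d.param (J.e.symm y) ∈ N.carrier := (param_mem_iff (symm_mem_params hJ)).2 h0.ge
      have h2 : d.param (J.e.symm y) ∈ boundary N.carrier := by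
        refine (hN.mem_boundary_iff d h1 hmJ.2.1).2 ?_
        rw [φ_param (symm_mem_params hJ)]; exact h0
      have h3 : d.param (J.e.symm y) ∈ boundary M.carrier := h.1 ▸ h2
      have h4 := (hM.mem_boundary_iff c h3.1 hmJ.1.1).1 h3
      rwa [← symm_apply h3.1 hmJ.1, apply_param_symm hJ] at h4
    · intro h0
      have h1 : c.param (I.e.symm y) ∈ M.carrier := (param_mem_iff (symm_mem_params hI)).2 h0.ge
      have h2 : c.param (I.e.symm y) ∈ boundary M.carrier := by
        refine (hM.mem_boundary_iff c h1 hmI.1.1).2 ?_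
        rw [φ_param (symm_mem_params hI)]; exact h0
      have h3 : c.param (I.e.symm y) ∈ boundary N.carrier := h.1 ▸ h2
      have h4 := (hN.mem_boundary_iff d h3.1 hmI.2.1).1 h3
      rwa [← symm_apply h3.1 hmI.2, apply_param_symm hI] at h4
  have hLp : I.e (c.φ p).1 = L p := apply_coord hp.1 (mem_nhd hs)
  have hIc : Tendsto I.e (𝓝 (c.φ p).1) (𝓝 (L p)) := by
    have h1 := (I.e.continuousAt I.coord_mem).tendsto
    rwa [hLp] at h1
  have hIe : HasFDerivAt I.e (L.comp (c.paramDeriv (c.φ p).1)) (c.φ p).1 := by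
    have h1 : (I.e : (Fin n → ℝ) → (Fin n → ℝ)) = fun t => L (c.param t) := funext I.coe_eq
    rw [h1]
    exact L.hasFDerivAt.comp _
      (hasStrictFDerivAt_param (coord_mem_params hp.1 hs)).hasFDerivAt
  -- Needed to transport the common inward direction u to the parameters of M, as `I.deriv u`.
  have hinv : L.comp (c.paramDeriv (c.φ p).1) (I.deriv u) = u := by
    have h1 : HasFDerivAt (I.e ∘ I.e.symm) ((L.comp (c.paramDeriv (c.φ p).1)).comp I.deriv)
        (L p) := by
      refine HasFDerivAt.comp (L p) ?_ I.hasFDerivAt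
      rwa [symm_apply hp.1 (mem_nhd hs)]
    have h2 : I.e ∘ I.e.symm =ᶠ[𝓝 (L p)] id := by
      filter_upwards [I.eventually_mem_target hp.1 hs] with y hy using I.e.right_inv hy
    have h3 := (h1.congr_of_eventuallyEq h2.symm).unique (hasFDerivAt_id _)
    exact congrArg (fun f : (Fin n → ℝ) →L[ℝ] (Fin n → ℝ) => f u) h3
  -- In the parameters t of M, the condition for M is the linear one t₀ ≥ 0, while that for N is the
  -- sign of k, the coordinate 0 of the local inverse of N over the same y.
  have hsign := eventually_nonneg_iff (E := Fin n → ℝ) (k := fun t => J.e.symm (I.e t) 0)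
    (k' := (ContinuousLinearMap.proj 0).comp
      (J.deriv.comp (L.comp (c.paramDeriv (c.φ p).1))))
    (ℓ := ContinuousLinearMap.proj 0) (a := (c.φ p).1) (u := I.deriv u)
    (by
      have h1 : HasFDerivAt (J.e.symm ∘ I.e) (J.deriv.comp (L.comp (c.paramDeriv (c.φ p).1)))
          (c.φ p).1 := HasFDerivAt.comp _ (by rw [hLp]; exact J.hasFDerivAt) hIe
      exact (ContinuousLinearMap.proj (R := ℝ) (φ := fun _ : Fin n => ℝ) 0).hasFDerivAt.comp _ h1)
    (by
      rw [hLp, symm_apply hpN.1 (mem_nhd hs')]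
      exact (hN.mem_boundary_iff d hpN.1 hs').1 hpN)
    ((hM.mem_boundary_iff c hp.1 hs).1 hp)
    (by
      filter_upwards [I.e.open_source.mem_nhds I.coord_mem,
        hIc.eventually (J.eventually_mem_target hpN.1 hs')] with t ht ht'
      exact (continuous_apply (0 : Fin n)).continuousAt.comp
        ((J.e.symm.continuousAt ht').comp (I.e.continuousAt ht)))
    (by
      filter_upwards [I.e.open_source.mem_nhds I.coord_mem, hIc.eventually hzero] with t ht h0
      rw [I.e.left_inv ht] at h0
      exact h0)
    (by
      change 0 < J.deriv (L.comp (c.paramDeriv (c.φ p).1) (I.deriv u)) 0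
      rwa [hinv])
    hu
  filter_upwards [I.eventually_mem_iff hp.1 hs hW (hWO.trans inter_subset_left),
    J.eventually_mem_iff hpN.1 hs' hW (hWO.trans inter_subset_right),
    (I.tendsto_symm hp.1 hs).eventually hsign, I.eventually_mem_target hp.1 hs] with y h1 h2 h3 h4
  rw [h1, h2]
  rw [I.e.right_inv h4] at h3
  exact h3

end Boundary

theorem ncard_fiber_of_injOn {n : ℕ} {L : DSpace n →L[ℝ] (Fin n → ℝ)} {S : Set (DSpace n)}
    (h : InjOn L S) (y : Fin n → ℝ)
    [Decidable (∃ z ∈ S, L z = y)] :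
    (S ∩ L ⁻¹' {y}).ncard = if ∃ z ∈ S, L z = y then 1 else 0 := by
  split_ifs with hy
  · obtain ⟨z, hz, rfl⟩ := hy
    refine ncard_eq_one.2 ⟨z, ?_⟩
    ext x
    exact ⟨fun hx => h hx.1 hz hx.2, fun hx => by rw [hx]; exact ⟨hz, rfl⟩⟩
  · have h1 : S ∩ L ⁻¹' {y} = ∅ := by
      ext x
      simp only [mem_inter_iff, mem_preimage, mem_singleton_iff, mem_empty_iff_false, iff_false]
      exact fun hx => hy ⟨x, hx.1, hx.2⟩
    rw [h1, ncard_empty]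

/-! ### Fibres of M and N have equal cardinality -/

section Degree

variable {M N : OrientedSubmanifold n} {L : DSpace n →L[ℝ] (Fin n → ℝ)}

theorem OrientedSubmanifold.IsPositiveFor.exists_injOn (hL : M.IsPositiveFor L)
    {p : DSpace n} (hp : p ∈ M.carrier) : ∃ O ∈ 𝓝 p, InjOn L (M.carrier ∩ O) := by
  obtain ⟨c, hs⟩ := M.isSubmanifold p hp
  obtain ⟨I⟩ := hL.exists_localInverse c hp hs
  exact ⟨_, I.isOpen_nhd.mem_nhds (mem_nhd hs), I.injOn⟩

theorem finite_fiber (hMc : IsCompact M.carrier) (hL : M.IsPositiveFor L) (y : Fin n → ℝ) :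
    (M.carrier ∩ L ⁻¹' {y}).Finite := by
  have h1 : (M.carrier ∩ (M.carrier ∩ L ⁻¹' {y})).Finite := by
    refine hMc.induction_on (p := fun s => (s ∩ (M.carrier ∩ L ⁻¹' {y})).Finite) (by simp)
      (fun s t hst ht => ht.subset (inter_subset_inter_left _ hst))
      (fun s t hs ht => by rw [union_inter_distrib_right]; exact hs.union ht) fun p hp => ?_
    obtain ⟨O, hO, hinj⟩ := hL.exists_injOn hp
    refine ⟨O, mem_nhdsWithin_of_mem_nhds hO, Set.Subsingleton.finite fun z hz w hw => ?_⟩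
    exact hinj ⟨hz.2.1, hz.1⟩ ⟨hw.2.1, hw.1⟩ (hz.2.2.trans hw.2.2.symm)
  exact h1.subset fun z hz => ⟨hz.1, hz⟩

/-- The constant is 1 at an interior point of M and 0 off the closed set M. All small W are allowed
so that neighbourhoods can later be shrunk to be disjoint. -/
theorem eventually_ncard_eq_of_notMem_boundary (hMc : IsCompact M.carrier)
    (hL : M.IsPositiveFor L) {p : DSpace n} (hp : p ∉ boundary M.carrier) :
    ∃ O ∈ 𝓝 p, ∀ W ∈ 𝓝 p, W ⊆ O → ∃ k : ℕ, ∀ᶠ y in 𝓝 (L p),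
      (M.carrier ∩ W ∩ L ⁻¹' {y}).ncard = k := by
  classical
  by_cases hpM : p ∈ M.carrier
  · obtain ⟨c, hs⟩ := M.isSubmanifold p hpM
    obtain ⟨I⟩ := hL.exists_localInverse c hpM hs
    refine ⟨_, I.isOpen_nhd.mem_nhds (mem_nhd hs), fun W hW hWI => ⟨1, ?_⟩⟩
    have hpos : 0 < (c.φ p).1 0 := lt_of_le_of_ne (coord_mem_dom hpM hs).2
      fun h => hp ((hL.mem_boundary_iff c hpM hs).2 h.symm)
    filter_upwards [I.eventually_mem_iff hpM hs hW hWI, (I.tendsto_symm hpM hs).eventually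
      ((isOpen_lt continuous_const (continuous_apply 0)).mem_nhds hpos)] with y h1 h2
    rw [ncard_fiber_of_injOn (I.injOn.mono (inter_subset_inter_right _ hWI)),
      if_pos (h1.2 (le_of_lt h2))]
  · refine ⟨M.carrierᶜ, hMc.isClosed.isOpen_compl.mem_nhds hpM, fun W _ hWM => ⟨0, ?_⟩⟩
    refine Eventually.of_forall fun y => ?_
    have h1 : M.carrier ∩ W = ∅ := by
      ext x
      exact ⟨fun hx => hWM hx.2 hx.1, fun hx => hx.elim⟩
    simp [h1]

/-- The difference of the numbers of points of `M` and `N` over `y` does not change near a common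
image point. -/
theorem eventually_ncard_sub_eq (hMc : IsCompact M.carrier) (hNc : IsCompact N.carrier)
    (hM : M.IsPositiveFor L) (hN : N.IsPositiveFor L) (h : M.SameOrientedBoundary N)
    (p : DSpace n) :
    ∃ O ∈ 𝓝 p, ∀ W ∈ 𝓝 p, W ⊆ O → ∃ k : ℤ, ∀ᶠ y in 𝓝 (L p),
      ((M.carrier ∩ W ∩ L ⁻¹' {y}).ncard : ℤ) - (N.carrier ∩ W ∩ L ⁻¹' {y}).ncard = k := by
  classical
  by_cases hp : p ∈ boundary M.carrier
  · obtain ⟨O, hO, h1, h2, h3⟩ := eventually_mem_image_iff hM hN h hp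
    refine ⟨O, hO, fun W hW hWO => ⟨0, ?_⟩⟩
    filter_upwards [h3 W hW hWO] with y hy
    rw [ncard_fiber_of_injOn (h1.mono (inter_subset_inter_right _ hWO)),
      ncard_fiber_of_injOn (h2.mono (inter_subset_inter_right _ hWO))]
    by_cases hz : ∃ z ∈ N.carrier ∩ W, L z = y
    · rw [if_pos hz, if_pos (hy.2 hz), sub_self]
    · rw [if_neg hz, if_neg fun h => hz (hy.1 h), sub_self]
  · obtain ⟨O, hO, h1⟩ := eventually_ncard_eq_of_notMem_boundary hMc hM hp
    obtain ⟨O', hO', h1'⟩ := eventually_ncard_eq_of_notMem_boundary hNc hN (h.1 ▸ hp)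
    refine ⟨O ∩ O', inter_mem hO hO', fun W hW hWO => ?_⟩
    obtain ⟨k, hk⟩ := h1 W hW (hWO.trans inter_subset_left)
    obtain ⟨k', hk'⟩ := h1' W hW (hWO.trans inter_subset_right)
    refine ⟨k - k', ?_⟩
    filter_upwards [hk, hk'] with y h1 h2
    rw [h1, h2]

/-- The image of the compact set M \ O is closed and misses y₀, so no new fibre points appear far
from the old ones. -/
theorem eventually_fiber_subset (hMc : IsCompact M.carrier) {y₀ : Fin n → ℝ}
    {O : Set (DSpace n)} (hO : IsOpen O) (h : M.carrier ∩ L ⁻¹' {y₀} ⊆ O) :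
    ∀ᶠ y in 𝓝 y₀, M.carrier ∩ L ⁻¹' {y} ⊆ O := by
  have h1 : IsClosed (L '' (M.carrier \ O)) :=
    ((hMc.diff hO).image L.continuous).isClosed
  have h2 : y₀ ∉ L '' (M.carrier \ O) := by
    rintro ⟨z, hz, rfl⟩
    exact hz.2 (h ⟨hz.1, rfl⟩)
  filter_upwards [h1.isOpen_compl.mem_nhds h2] with y hy z hz
  by_contra hzO
  exact hy ⟨z, ⟨hz.1, hzO⟩, hz.2⟩

theorem ncard_fiber_eq_sum (hMc : IsCompact M.carrier) (hL : M.IsPositiveFor L)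
    {y : Fin n → ℝ} {F : Finset (DSpace n)} {W : DSpace n → Set (DSpace n)}
    (hdisj : (F : Set (DSpace n)).PairwiseDisjoint W)
    (h : M.carrier ∩ L ⁻¹' {y} ⊆ ⋃ p ∈ F, W p) :
    (M.carrier ∩ L ⁻¹' {y}).ncard = ∑ p ∈ F, (M.carrier ∩ W p ∩ L ⁻¹' {y}).ncard := by
  have hfin := finite_fiber hMc hL y
  have h1 : M.carrier ∩ L ⁻¹' {y} = ⋃ p ∈ (F : Set (DSpace n)), M.carrier ∩ W p ∩ L ⁻¹' {y} := by
    ext z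
    simp only [mem_iUnion]
    constructor
    · intro hz
      obtain ⟨p, hp, hzp⟩ := mem_iUnion₂.1 (h hz)
      exact ⟨p, hp, ⟨hz.1, hzp⟩, hz.2⟩
    · rintro ⟨p, -, hz⟩
      exact ⟨hz.1.1, hz.2⟩
  rw [h1, Set.Finite.ncard_biUnion F.finite_toSet (fun p _ => hfin.subset fun z hz => ⟨hz.1.1, hz.2⟩)
    (hdisj.mono fun p z hz => hz.1.2), finsum_mem_coe_finset]

/-- The fibres of M and N over y₀ are finite; around their points take disjoint neighbourhoods on
which the local difference is constant. For y near y₀ both fibres stay in these, and the differences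
add up. -/
theorem isLocallyConstant_ncard_sub (hMc : IsCompact M.carrier) (hNc : IsCompact N.carrier)
    (hM : M.IsPositiveFor L) (hN : N.IsPositiveFor L) (h : M.SameOrientedBoundary N) :
    IsLocallyConstant fun y : Fin n → ℝ =>
      ((M.carrier ∩ L ⁻¹' {y}).ncard : ℤ) - (N.carrier ∩ L ⁻¹' {y}).ncard := by
  refine (IsLocallyConstant.iff_eventually_eq _).2 fun y₀ => ?_
  have hfin := (finite_fiber hMc hM y₀).union (finite_fiber hNc hN y₀)
  obtain ⟨U, hU, hdisj⟩ := hfin.t2_separation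
  choose O hO hOk using fun p => eventually_ncard_sub_eq hMc hNc hM hN h p
  let W : DSpace n → Set (DSpace n) := fun p => U p ∩ interior (O p)
  have hWo : ∀ p, IsOpen (W p) := fun p => (hU p).2.inter isOpen_interior
  have hpW : ∀ p, p ∈ W p := fun p => ⟨(hU p).1, mem_interior_iff_mem_nhds.2 (hO p)⟩
  choose k hk using fun p => hOk p (W p) ((hWo p).mem_nhds (hpW p))
    (inter_subset_right.trans interior_subset)
  let F := hfin.toFinset
  have hF : ∀ p, p ∈ F ↔ p ∈ M.carrier ∩ L ⁻¹' {y₀} ∪ N.carrier ∩ L ⁻¹' {y₀} :=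
    fun p => hfin.mem_toFinset
  have hdisjW : (F : Set (DSpace n)).PairwiseDisjoint W := by
    rw [hfin.coe_toFinset]
    exact hdisj.mono fun p => inter_subset_left
  have hUo : IsOpen (⋃ p ∈ F, W p) := isOpen_biUnion fun p _ => hWo p
  have hkF : ∀ᶠ y in 𝓝 y₀, ∀ p ∈ F,
      ((M.carrier ∩ W p ∩ L ⁻¹' {y}).ncard : ℤ) - (N.carrier ∩ W p ∩ L ⁻¹' {y}).ncard = k p := by
    refine (Filter.eventually_all_finset F).2 fun p hp => ?_
    have hLp : L p = y₀ := by
      rcases (hF p).1 hp with h | h <;> exact h.2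
    rw [← hLp]
    exact hk p
  have key : ∀ᶠ y in 𝓝 y₀,
      ((M.carrier ∩ L ⁻¹' {y}).ncard : ℤ) - (N.carrier ∩ L ⁻¹' {y}).ncard = ∑ p ∈ F, k p := by
    filter_upwards [hkF,
      eventually_fiber_subset hMc hUo fun p hp => mem_biUnion ((hF p).2 (Or.inl hp)) (hpW p),
      eventually_fiber_subset hNc hUo fun p hp => mem_biUnion ((hF p).2 (Or.inr hp)) (hpW p)]
      with y h1 h2 h3
    rw [ncard_fiber_eq_sum hMc hM hdisjW h2, ncard_fiber_eq_sum hNc hN hdisjW h3]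
    push_cast
    rw [← Finset.sum_sub_distrib]
    exact Finset.sum_congr rfl h1
  filter_upwards [key] with y hy
  rw [hy, key.self_of_nhds]

/-- Two compact submanifolds with the same oriented boundary on which `L` is positive have equally
many points over each point. -/
theorem ncard_fiber_eq (hMc : IsCompact M.carrier) (hNc : IsCompact N.carrier)
    (hM : M.IsPositiveFor L) (hN : N.IsPositiveFor L) (h : M.SameOrientedBoundary N)
    (y : Fin n → ℝ) : (M.carrier ∩ L ⁻¹' {y}).ncard = (N.carrier ∩ L ⁻¹' {y}).ncard := by
  -- For n ≥ 1 the space ℝⁿ is not compact, so some point has empty fibres in both M and N.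
  have h1 : L '' M.carrier ∪ L '' N.carrier ≠ univ :=
    ((hMc.image L.continuous).union (hNc.image L.continuous)).ne_univ
  obtain ⟨y₀, hy₀⟩ := (ne_univ_iff_exists_notMem _).1 h1
  have h2 := (isLocallyConstant_ncard_sub hMc hNc hM hN h).apply_eq_of_preconnectedSpace y y₀
  have hM0 : M.carrier ∩ L ⁻¹' {y₀} = ∅ := by
    ext z; exact ⟨fun hz => hy₀ (Or.inl ⟨z, hz⟩), fun hz => hz.elim⟩
  have hN0 : N.carrier ∩ L ⁻¹' {y₀} = ∅ := by
    ext z; exact ⟨fun hz => hy₀ (Or.inr ⟨z, hz⟩), fun hz => hz.elim⟩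
  simp only [hM0, hN0, ncard_empty, sub_self] at h2
  exact_mod_cast sub_eq_zero.1 h2

end Degree

/-! ### The area formula and the volume measure -/

open scoped ENNReal

namespace HalfSpaceChart

variable {M : Set (DSpace n)} {c : HalfSpaceChart M}

variable (c) in
theorem measurableSet_dom : MeasurableSet c.dom :=
  c.isOpen_params.measurableSet.inter
    (isClosed_le continuous_const (continuous_apply 0)).measurableSet

theorem continuousOn_param_dom : ContinuousOn c.param c.dom :=
  continuousOn_param.mono fun _ h => h.1

variable (c) in
/-- The parameters in the domain of a chart of the points of a set. -/
def paramsOf (E : Set (DSpace n)) : Set (Fin n → ℝ) := c.param ⁻¹' E ∩ c.dom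

theorem measurableSet_paramsOf {E : Set (DSpace n)} (hE : MeasurableSet E) :
    MeasurableSet (c.paramsOf E) := by
  have h1 : Measurable (c.dom.domRestrict c.param) :=
    (continuousOn_iff_continuous_domRestrict.1 continuousOn_param_dom).measurable
  have h2 := c.measurableSet_dom.subtype_image (h1 hE)
  have h3 : Subtype.val '' (c.dom.domRestrict c.param ⁻¹' E) = c.paramsOf E := by
    ext t
    simp only [mem_image, mem_preimage, Subtype.exists, exists_and_right, exists_eq_right,
      domRestrict_apply]
    exact ⟨fun ⟨h, h'⟩ => ⟨h', h⟩, fun h => ⟨h.2, h.1⟩⟩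
  rwa [h3] at h2

theorem param_mem {t : Fin n → ℝ} (ht : t ∈ c.dom) : c.param t ∈ M ∩ c.φ.source :=
  ⟨(param_mem_iff ht.1).2 ht.2, param_mem_source ht.1⟩

theorem injOn_param : InjOn c.param c.params := fun s hs t ht h => by
  have h1 := congrArg c.φ h
  rw [φ_param hs, φ_param ht] at h1
  exact congrArg Prod.fst h1

theorem image_paramsOf {E : Set (DSpace n)} (hE : E ⊆ M ∩ c.φ.source) :
    c.param '' c.paramsOf E = E := by
  ext z
  constructor
  · rintro ⟨t, ht, rfl⟩
    exact ht.1
  · intro hz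
    have h1 := param_coord (hE hz).1 (hE hz).2
    exact ⟨_, ⟨by rw [mem_preimage, h1]; exact hz, coord_mem_dom (hE hz).1 (hE hz).2⟩, h1⟩

/-- The area formula for the restriction of `L` to a piece of `M` on which it is injective. -/
theorem lintegral_image (L : DSpace n →L[ℝ] (Fin n → ℝ)) {E : Set (DSpace n)}
    (hE : E ⊆ M ∩ c.φ.source) (hEm : MeasurableSet E) (hinj : InjOn L E)
    (g : (Fin n → ℝ) → ℝ≥0∞) :
    ∫⁻ y in L '' E, g y = ∫⁻ t in c.paramsOf E,
      ENNReal.ofReal |(frameMatrix L (c.frame t)).det| * g (L (c.param t)) := by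
  have h1 : L '' E = (fun t => L (c.param t)) '' c.paramsOf E := by
    rw [← image_image L c.param, image_paramsOf hE]
  rw [h1, lintegral_image_eq_lintegral_abs_det_fderiv_mul volume (measurableSet_paramsOf hEm)
    (f := fun t => L (c.param t)) (f' := fun t => L.comp (c.paramDeriv t))
    (fun t ht => (L.hasFDerivAt.comp t
      (hasStrictFDerivAt_param ht.2.1).hasFDerivAt).hasFDerivWithinAt)
    (fun s hs t ht h => injOn_param hs.2.1 ht.2.1 (hinj hs.1 ht.1 h))]
  simp only [det_comp_paramDeriv]

theorem volume_image (L : DSpace n →L[ℝ] (Fin n → ℝ)) {E : Set (DSpace n)}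
    (hE : E ⊆ M ∩ c.φ.source) (hEm : MeasurableSet E) (hinj : InjOn L E) :
    volume (L '' E) = ∫⁻ t in c.paramsOf E,
      ENNReal.ofReal |(frameMatrix L (c.frame t)).det| := by
  have h1 := lintegral_image L hE hEm hinj fun _ => 1
  simpa using h1

end HalfSpaceChart

section Volume

variable {M : OrientedSubmanifold n} {L : DSpace n →L[ℝ] (Fin n → ℝ)}

theorem chartVolume_apply (c : HalfSpaceChart M.carrier) {E : Set (DSpace n)}
    (hE : MeasurableSet E) : M.chartVolume c E =
      ∫⁻ t in c.paramsOf E, ENNReal.ofReal √(gram (c.frame t)).det := by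
  have h1 : AEMeasurable c.param ((volume : Measure (Fin n → ℝ)).restrict c.dom) :=
    continuousOn_param_dom.aemeasurable c.measurableSet_dom
  have h2 := h1.mono_ac (withDensity_absolutelyContinuous _
    (fun t => ENNReal.ofReal (M.volumeDensity c t)))
  change Measure.map c.param _ E = _
  rw [Measure.map_apply_of_aemeasurable h2 hE, withDensity_apply',
    Measure.restrict_restrict' c.measurableSet_dom]
  rfl

theorem chartVolume_inter (c : HalfSpaceChart M.carrier) {E : Set (DSpace n)}
    (hE : MeasurableSet E) (hM : MeasurableSet M.carrier) :
    M.chartVolume c E = M.chartVolume c (E ∩ (M.carrier ∩ c.φ.source)) := by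
  rw [chartVolume_apply c hE,
    chartVolume_apply c (hE.inter (hM.inter c.φ.open_source.measurableSet))]
  congr 2
  ext t
  exact ⟨fun h => ⟨⟨h.1, param_mem h.2⟩, h.2⟩, fun h => ⟨h.1.1, h.2⟩⟩

/-- The ratio of metric volume to projected volume depends only on the tangent plane, hence on the
point and not on the chart. -/
theorem OrientedSubmanifold.IsPositiveFor.exists_density (hL : M.IsPositiveFor L) :
    ∃ ρ : DSpace n → ℝ, ∀ c : HalfSpaceChart M.carrier, ∀ t ∈ c.dom,
      √(gram (c.frame t)).det = |(frameMatrix L (c.frame t)).det| * ρ (c.param t) := by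
  classical
  choose r hr using fun p => (hL p).exists_density
  refine ⟨fun p => if h : p ∈ M.carrier then r ⟨p, h⟩ else 0, fun c t ht => ?_⟩
  simp only [dif_pos (param_mem ht).1]
  exact hr ⟨c.param t, (param_mem ht).1⟩ _ fun i => frame_mem_tangentSpace ht i

/-- The volumes defined by two charts agree. -/
theorem chartVolume_eq_chartVolume (hL : M.IsPositiveFor L) (c d : HalfSpaceChart M.carrier)
    {E : Set (DSpace n)} (hEm : MeasurableSet E) (hc : E ⊆ M.carrier ∩ c.φ.source)
    (hd : E ⊆ M.carrier ∩ d.φ.source) (hinj : InjOn L E) :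
    M.chartVolume c E = M.chartVolume d E := by
  obtain ⟨ρ, hρ⟩ := hL.exists_density
  -- Both chart volumes are compared with one integral over the image in ℝⁿ, which mentions no
  -- chart; transition maps are never needed.
  have key : ∀ c : HalfSpaceChart M.carrier, E ⊆ M.carrier ∩ c.φ.source →
      M.chartVolume c E = ∫⁻ y in L '' E, ENNReal.ofReal (ρ (Function.invFunOn L E y)) := by
    intro c hc
    rw [chartVolume_apply c hEm, lintegral_image L hc hEm hinj]
    refine setLIntegral_congr_fun (measurableSet_paramsOf hEm) fun t ht => ?_
    rw [hρ c t ht.2, ENNReal.ofReal_mul (abs_nonneg _), hinj.leftInvOn_invFunOn ht.1]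
  rw [key c hc, key d hd]

/-- A finite partition of `M` into measurable pieces, each in the domain of a chart and with `L`
injective on each piece. -/
structure ChartPartition (M : OrientedSubmanifold n) (Ls : Set (DSpace n →L[ℝ] (Fin n → ℝ)))
    (m : ℕ) where
  chart : Fin m → HalfSpaceChart M.carrier
  piece : Fin m → Set (DSpace n)
  measurableSet : ∀ k, MeasurableSet (piece k)
  disjoint : Pairwise (Function.onFun Disjoint piece)
  iUnion : ⋃ k, piece k = M.carrier
  subset_source : ∀ k, piece k ⊆ (chart k).φ.source
  injOn : ∀ k, ∀ L ∈ Ls, InjOn L (piece k)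

namespace ChartPartition

variable {Ls : Set (DSpace n →L[ℝ] (Fin n → ℝ))} {m : ℕ}

theorem subset (π : ChartPartition M Ls m) (k : Fin m) : π.piece k ⊆ M.carrier ∩ (π.chart k).φ.source := fun z hz =>
  ⟨by rw [← π.iUnion]; exact mem_iUnion.2 ⟨k, hz⟩, π.subset_source k hz⟩

theorem measurableSet_carrier (π : ChartPartition M Ls m) : MeasurableSet M.carrier := by
  rw [← π.iUnion]; exact MeasurableSet.iUnion π.measurableSet

/-- Gluing the chart volumes along the pieces gives a measure that dominates every chart volume,
hence the supremum; conversely the supremum dominates each chart volume on its own piece. -/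
theorem vol_eq (π : ChartPartition M Ls m) (hL : M.IsPositiveFor L) (hmem : L ∈ Ls) :
    M.vol = ∑ k, M.chartVolume (π.chart k) (π.piece k) := by
  have hMm := π.measurableSet_carrier
  have hsum : ∀ μ : Measure (DSpace n), μ M.carrier = ∑ k, μ (π.piece k) := fun μ => by
    rw [← π.iUnion, measure_iUnion π.disjoint π.measurableSet, tsum_fintype]
  apply le_antisymm
  · let μ : Measure (DSpace n) :=
      ∑ k, (M.chartVolume (π.chart k)).restrict (π.piece k)
    have hμ : ∀ E, μ E = ∑ k, (M.chartVolume (π.chart k)).restrict (π.piece k) E := fun E => by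
      simp [μ, Measure.finsetSum_apply]
    have hle : M.volumeMeasure ≤ μ := by
      refine iSup_le fun c => Measure.le_iff.2 fun E hE => ?_
      rw [chartVolume_inter c hE hMm, hμ]
      set E' := E ∩ (M.carrier ∩ c.φ.source) with hE'
      have hE'm : MeasurableSet E' := hE.inter (hMm.inter c.φ.open_source.measurableSet)
      have h1 : E' = ⋃ k, E' ∩ π.piece k := by
        rw [← inter_iUnion, π.iUnion]
        exact (inter_eq_left.2 fun z hz => hz.2.1).symm
      rw [h1, measure_iUnion (fun i j hij => (π.disjoint hij).mono inter_subset_right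
        inter_subset_right) (fun k => hE'm.inter (π.measurableSet k)), tsum_fintype]
      refine Finset.sum_le_sum fun k _ => ?_
      rw [Measure.restrict_apply hE, chartVolume_eq_chartVolume hL c (π.chart k)
        (hE'm.inter (π.measurableSet k)) (fun z hz => hz.1.2)
        (fun z hz => π.subset k hz.2) ((π.injOn k L hmem).mono inter_subset_right)]
      exact measure_mono fun z hz => ⟨hz.1.1, hz.2⟩
    refine (hle M.carrier).trans_eq ?_
    rw [hμ]
    refine Finset.sum_congr rfl fun k _ => ?_
    rw [Measure.restrict_apply hMm, inter_eq_right.2 fun z hz => (π.subset k hz).1]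
  · change _ ≤ M.volumeMeasure M.carrier
    rw [hsum]
    exact Finset.sum_le_sum fun k _ =>
      (le_iSup (fun c => M.chartVolume c) (π.chart k) : _ ≤ M.volumeMeasure) _

/-- L is injective on each piece, so the number of points over y is the number of pieces whose image
contains y; the area formula then applies piecewise. -/
theorem lintegral_ncard_eq (π : ChartPartition M Ls m) (hL : M.IsPositiveFor L)
    (hMc : IsCompact M.carrier) (hmem : L ∈ Ls) :
    ∫⁻ y, ((M.carrier ∩ L ⁻¹' {y}).ncard : ℝ≥0∞) =
      ∑ k, ∫⁻ t in (π.chart k).paramsOf (π.piece k),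
        ENNReal.ofReal |(frameMatrix L ((π.chart k).frame t)).det| := by
  classical
  have hmeas : ∀ k, MeasurableSet (L '' π.piece k) := fun k =>
    (π.measurableSet k).image_of_continuousOn_injOn L.continuous.continuousOn (π.injOn k L hmem)
  have h1 : ∀ y, ((M.carrier ∩ L ⁻¹' {y}).ncard : ℝ≥0∞) =
      ∑ k, (L '' π.piece k).indicator 1 y := by
    intro y
    have h2 : M.carrier ∩ L ⁻¹' {y} = ⋃ k, π.piece k ∩ L ⁻¹' {y} := by
      rw [← iUnion_inter, π.iUnion]
    rw [h2, ncard_iUnion_of_finite (fun k => (finite_fiber hMc hL y).subset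
      (inter_subset_inter_left _ fun z hz => (π.subset k hz).1))
      (fun i j hij => (π.disjoint hij).mono inter_subset_left inter_subset_left),
      finsum_eq_sum_of_fintype]
    push_cast
    refine Finset.sum_congr rfl fun k _ => ?_
    rw [ncard_fiber_of_injOn (π.injOn k L hmem), indicator_apply]
    simp only [mem_image]
    split_ifs <;> simp
  simp only [h1]
  rw [lintegral_finsetSum _ fun k _ => measurable_one.indicator (hmeas k)]
  refine Finset.sum_congr rfl fun k _ => ?_
  rw [lintegral_indicator_one (hmeas k), volume_image L (π.subset k) (π.measurableSet k)
    (π.injOn k L hmem)]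

theorem lintegral_ncard_lt_top (π : ChartPartition M Ls m) (hL : M.IsPositiveFor L)
    (hMc : IsCompact M.carrier) (hmem : L ∈ Ls) :
    ∫⁻ y, ((M.carrier ∩ L ⁻¹' {y}).ncard : ℝ≥0∞) < ⊤ := by
  rw [π.lintegral_ncard_eq hL hMc hmem]
  refine ENNReal.sum_lt_top.2 fun k _ => ?_
  rw [← volume_image L (π.subset k) (π.measurableSet k) (π.injOn k L hmem)]
  exact (measure_mono (image_mono fun z hz => (π.subset k hz).1)).trans_lt
    (hMc.image L.continuous).measure_lt_top

end ChartPartition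

end Volume

/-! ### Existence of chart partitions -/

section Partition

variable {M : OrientedSubmanifold n} {L₁ L₂ : DSpace n →L[ℝ] (Fin n → ℝ)}

/-- An open set contained in the domain of a chart, on which the two maps are injective. -/
structure SmallOpen (M : OrientedSubmanifold n) (L₁ L₂ : DSpace n →L[ℝ] (Fin n → ℝ)) where
  chart : HalfSpaceChart M.carrier
  set : Set (DSpace n)
  isOpen : IsOpen set
  subset : set ⊆ chart.φ.source
  injOn₁ : InjOn L₁ (M.carrier ∩ set)
  injOn₂ : InjOn L₂ (M.carrier ∩ set)

theorem exists_smallOpen (h₁ : M.IsPositiveFor L₁) (h₂ : M.IsPositiveFor L₂) {p : DSpace n}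
    (hp : p ∈ M.carrier) : ∃ s : SmallOpen M L₁ L₂, p ∈ s.set := by
  obtain ⟨c, hs⟩ := M.isSubmanifold p hp
  obtain ⟨I⟩ := h₁.exists_localInverse c hp hs
  obtain ⟨J⟩ := h₂.exists_localInverse c hp hs
  exact ⟨⟨c, I.nhd ∩ J.nhd, I.isOpen_nhd.inter J.isOpen_nhd, fun z hz => hz.1.1,
    I.injOn.mono (inter_subset_inter_right _ inter_subset_left),
    J.injOn.mono (inter_subset_inter_right _ inter_subset_right)⟩, mem_nhd hs, mem_nhd hs⟩

/-- The partition of `M` obtained from a finite open cover. -/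
theorem exists_chartPartition_of_cover (hMc : IsCompact M.carrier) {m : ℕ}
    (s : Fin m → SmallOpen M L₁ L₂) (hs : M.carrier ⊆ ⋃ k, (s k).set) :
    ∃ π : ChartPartition M {L₁, L₂} m, π.chart = (fun k => (s k).chart) ∧
      π.piece = disjointed fun k => M.carrier ∩ (s k).set := by
  have hsub : ∀ k, disjointed (fun k => M.carrier ∩ (s k).set) k ⊆ M.carrier ∩ (s k).set :=
    fun k => disjointed_subset _ k
  have hm : ∀ k, MeasurableSet (M.carrier ∩ (s k).set) := fun k =>
    hMc.measurableSet.inter (s k).isOpen.measurableSet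
  refine ⟨⟨fun k => (s k).chart, disjointed fun k => M.carrier ∩ (s k).set, fun k => ?_,
    disjoint_disjointed _, ?_, fun k => (hsub k).trans (inter_subset_right.trans (s k).subset),
    fun k L hL => ?_⟩, rfl, rfl⟩
  · rw [disjointed_eq_inter_compl]
    exact (hm k).inter (MeasurableSet.iInter fun j => MeasurableSet.iInter fun _ => (hm j).compl)
  · rw [iUnion_disjointed, ← inter_iUnion]
    exact inter_eq_left.2 hs
  · rcases hL with rfl | hL
    · exact (s k).injOn₁.mono (hsub k)
    · rw [mem_singleton_iff.1 hL]
      exact (s k).injOn₂.mono (hsub k)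

theorem exists_cover (hMc : IsCompact M.carrier) (h₁ : M.IsPositiveFor L₁)
    (h₂ : M.IsPositiveFor L₂) :
    ∃ (m : ℕ) (s : Fin m → SmallOpen M L₁ L₂), M.carrier ⊆ ⋃ k, (s k).set := by
  choose s hs using fun p : M.carrier => exists_smallOpen h₁ h₂ p.2
  obtain ⟨t, ht⟩ := hMc.elim_nhds_subcover' (fun p hp => (s ⟨p, hp⟩).set)
    fun p hp => (s ⟨p, hp⟩).isOpen.mem_nhds (hs ⟨p, hp⟩)
  refine ⟨t.card, fun k => s (t.equivFin.symm k), fun p hp => ?_⟩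
  obtain ⟨q, hqt, hq⟩ := mem_iUnion₂.1 (ht hp)
  refine mem_iUnion.2 ⟨t.equivFin ⟨q, hqt⟩, ?_⟩
  simpa using hq

theorem exists_chartPartition (hMc : IsCompact M.carrier) (h₁ : M.IsPositiveFor L₁)
    (h₂ : M.IsPositiveFor L₂) : ∃ m, Nonempty (ChartPartition M {L₁, L₂} m) := by
  obtain ⟨m, s, hs⟩ := exists_cover hMc h₁ h₂
  obtain ⟨π, -⟩ := exists_chartPartition_of_cover hMc s hs
  exact ⟨m, ⟨π⟩⟩

/-- A partition whose first piece is a neighbourhood of a given point. -/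
theorem exists_chartPartition_nhd (hMc : IsCompact M.carrier) (h₁ : M.IsPositiveFor L₁)
    (h₂ : M.IsPositiveFor L₂) {p : DSpace n} (hp : p ∈ M.carrier) :
    ∃ (m : ℕ) (π : ChartPartition M {L₁, L₂} (m + 1)) (O : Set (DSpace n)), IsOpen O ∧ p ∈ O ∧
      π.piece 0 = M.carrier ∩ O := by
  obtain ⟨m, s, hs⟩ := exists_cover hMc h₁ h₂
  obtain ⟨s₀, hps₀⟩ := exists_smallOpen h₁ h₂ hp
  -- The chosen set is placed first because `disjointed` leaves the first set untouched.
  obtain ⟨π, -, hπ⟩ := exists_chartPartition_of_cover hMc (Fin.cons s₀ s : Fin (m + 1) → _)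
    fun z hz => by
      obtain ⟨k, hk⟩ := mem_iUnion.1 (hs hz)
      exact mem_iUnion.2 ⟨k.succ, by simpa using hk⟩
  refine ⟨m, π, s₀.set, s₀.isOpen, hps₀, ?_⟩
  rw [hπ]
  exact disjointed_bot _

end Partition

/-! ### The calibration integral and the equality case -/

section Calibration

variable {M : OrientedSubmanifold n}

theorem OrientedSubmanifold.IsPositiveSpacelike.sumMap (h : M.IsPositiveSpacelike) :
    M.IsPositiveFor (sumMap n) := fun p => (h p).isPositiveOn_sumMap

theorem OrientedSubmanifold.IsPositiveSpacelike.diffMap (h : M.IsPositiveSpacelike) :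
    M.IsPositiveFor (diffMap n) := fun p => (h p).isPositiveOn_diffMap

theorem OrientedSubmanifold.IsSplitSLAG.sumMap (h : M.IsSplitSLAG) :
    M.IsPositiveFor (sumMap n) := fun p => (h p).isPositiveOn_sumMap

theorem OrientedSubmanifold.IsSplitSLAG.diffMap (h : M.IsSplitSLAG) :
    M.IsPositiveFor (diffMap n) := fun p => (h p).isPositiveOn_diffMap

/-- The integral over `M` of the calibration form, computed by counting points in the fibres of
`sumMap` and `diffMap`. -/
noncomputable def calibrationIntegral (M : OrientedSubmanifold n) : ℝ≥0∞ :=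
  2⁻¹ * ((∫⁻ y, ((M.carrier ∩ sumMap n ⁻¹' {y}).ncard : ℝ≥0∞)) +
    ∫⁻ y, ((M.carrier ∩ diffMap n ⁻¹' {y}).ncard : ℝ≥0∞))

theorem continuousOn_abs_det {S : Set (DSpace n)} (c : HalfSpaceChart S)
    (L : DSpace n →L[ℝ] (Fin n → ℝ)) :
    ContinuousOn (fun t => |(frameMatrix L (c.frame t)).det|) c.params :=
  ((continuous_id.matrix_det).comp_continuousOn (c.continuousOn_frameMatrix L)).abs

theorem continuousOn_calibration {S : Set (DSpace n)} (c : HalfSpaceChart S) :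
    ContinuousOn (fun t => calibration (c.frame t)) c.params := by
  exact ((continuousOn_abs_det c _).add (continuousOn_abs_det c _)).div_const 2

theorem continuousOn_sqrt_det_gram {S : Set (DSpace n)} (c : HalfSpaceChart S) :
    ContinuousOn (fun t => √(gram (c.frame t)).det) c.params := by
  simp only [gram_eq]
  have h1 := c.continuousOn_frameMatrix (.fst ℝ _ _)
  have h2 := c.continuousOn_frameMatrix (.snd ℝ _ _)
  have h3 : Continuous fun A : Matrix (Fin n) (Fin n) ℝ => A * A.transpose :=
    continuous_id.matrix_mul continuous_id.matrix_transpose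
  exact Real.continuous_sqrt.comp_continuousOn (continuous_id.matrix_det.comp_continuousOn
    ((h3.comp_continuousOn h1).sub (h3.comp_continuousOn h2)))

theorem aemeasurable_of_continuousOn {S : Set (DSpace n)} (c : HalfSpaceChart S)
    {f : (Fin n → ℝ) → ℝ} (hf : ContinuousOn f c.params) {E : Set (DSpace n)}
    (hE : MeasurableSet E) :
    AEMeasurable (fun t => ENNReal.ofReal (f t)) (volume.restrict (c.paramsOf E)) :=
  ((hf.mono fun _ h => h.2.1).aemeasurable (measurableSet_paramsOf hE)).ennreal_ofReal

theorem ChartPartition.calibrationIntegral_eq {m : ℕ}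
    (π : ChartPartition M {sumMap n, diffMap n} m) (h₁ : M.IsPositiveFor (sumMap n))
    (h₂ : M.IsPositiveFor (diffMap n)) (hMc : IsCompact M.carrier) :
    calibrationIntegral M = ∑ k, ∫⁻ t in (π.chart k).paramsOf (π.piece k),
        ENNReal.ofReal (calibration ((π.chart k).frame t)) := by
  rw [calibrationIntegral, π.lintegral_ncard_eq h₁ hMc (by simp),
    π.lintegral_ncard_eq h₂ hMc (by simp), ← Finset.sum_add_distrib, Finset.mul_sum]
  refine Finset.sum_congr rfl fun k _ => ?_
  rw [← lintegral_add_left' (aemeasurable_of_continuousOn _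
    (continuousOn_abs_det (π.chart k) _) (π.measurableSet k)),
    ← lintegral_const_mul' _ _ (by simp)]
  refine lintegral_congr fun t => ?_
  rw [calibration, ← ENNReal.ofReal_add (abs_nonneg _) (abs_nonneg _), div_eq_inv_mul,
    ENNReal.ofReal_mul (by norm_num), ENNReal.ofReal_inv_of_pos two_pos]
  norm_num

theorem ChartPartition.vol_eq_sum {m : ℕ} (π : ChartPartition M {sumMap n, diffMap n} m)
    (h₁ : M.IsPositiveFor (sumMap n)) :
    M.vol = ∑ k, ∫⁻ t in (π.chart k).paramsOf (π.piece k),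
        ENNReal.ofReal √(gram ((π.chart k).frame t)).det := by
  rw [π.vol_eq h₁ (by simp)]
  exact Finset.sum_congr rfl fun k _ => chartVolume_apply _ (π.measurableSet k)

theorem calibrationIntegral_lt_top (h₁ : M.IsPositiveFor (sumMap n))
    (h₂ : M.IsPositiveFor (diffMap n)) (hMc : IsCompact M.carrier) :
    calibrationIntegral M < ⊤ := by
  obtain ⟨m, ⟨π⟩⟩ := exists_chartPartition hMc h₁ h₂
  exact ENNReal.mul_lt_top (by simp) (ENNReal.add_lt_top.2
    ⟨π.lintegral_ncard_lt_top h₁ hMc (by simp), π.lintegral_ncard_lt_top h₂ hMc (by simp)⟩)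

theorem sqrt_det_gram_frame_le (h : M.IsPositiveSpacelike) (c : HalfSpaceChart M.carrier)
    {t : Fin n → ℝ} (ht : t ∈ c.dom) :
    √(gram (c.frame t)).det ≤ calibration (c.frame t) :=
  (h ⟨c.param t, (param_mem ht).1⟩).sqrt_det_gram_le fun i => frame_mem_tangentSpace ht i

theorem vol_le_calibrationIntegral (h : M.IsPositiveSpacelike) (hMc : IsCompact M.carrier) :
    M.vol ≤ calibrationIntegral M := by
  obtain ⟨m, ⟨π⟩⟩ := exists_chartPartition hMc h.sumMap h.diffMap
  rw [π.vol_eq_sum h.sumMap, π.calibrationIntegral_eq h.sumMap h.diffMap hMc]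
  exact Finset.sum_le_sum fun k _ => setLIntegral_mono' (measurableSet_paramsOf (π.measurableSet k))
    fun t ht => ENNReal.ofReal_le_ofReal (sqrt_det_gram_frame_le h _ ht.2)

theorem vol_eq_calibrationIntegral (h : M.IsSplitSLAG) (hMc : IsCompact M.carrier) :
    M.vol = calibrationIntegral M := by
  obtain ⟨m, ⟨π⟩⟩ := exists_chartPartition hMc h.sumMap h.diffMap
  rw [π.vol_eq_sum h.sumMap, π.calibrationIntegral_eq h.sumMap h.diffMap hMc]
  refine Finset.sum_congr rfl fun k _ =>
    setLIntegral_congr_fun (measurableSet_paramsOf (π.measurableSet k)) fun t ht => ?_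
  rw [(h ⟨(π.chart k).param t, (param_mem ht.2).1⟩).sqrt_det_gram_eq
    fun i => frame_mem_tangentSpace ht.2 i]

/-- Parameters near a point of the domain of a chart have positive measure. -/
theorem volume_dom_inter_ne_zero {S : Set (DSpace n)} (c : HalfSpaceChart S) {t : Fin n → ℝ}
    (ht : t ∈ c.dom) {V : Set (Fin n → ℝ)} (hV : V ∈ 𝓝 t) : volume (c.dom ∩ V) ≠ 0 := by
  -- At a boundary parameter, a small move along e₀ reaches the open part t₀ > 0 of the domain.
  have h1 : Tendsto (fun s : ℝ => t + s • (Pi.single 0 1 : Fin n → ℝ)) (𝓝[>] 0) (𝓝 t) := by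
    have : Continuous fun s : ℝ => t + s • (Pi.single 0 1 : Fin n → ℝ) := by fun_prop
    simpa using (this.tendsto 0).mono_left nhdsWithin_le_nhds
  have hV' : c.params ∩ interior V ∈ 𝓝 t :=
    inter_mem (c.isOpen_params.mem_nhds ht.1) (interior_mem_nhds.2 hV)
  obtain ⟨s, hs1, hs2⟩ := ((h1.eventually hV').and self_mem_nhdsWithin).exists
  have hs3 : (0 : ℝ) < s := hs2
  have hopen : IsOpen (c.params ∩ interior V ∩ {x | 0 < x 0}) :=
    (c.isOpen_params.inter isOpen_interior).inter
      (isOpen_lt continuous_const (continuous_apply 0))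
  have hne : (c.params ∩ interior V ∩ {x | 0 < x 0}).Nonempty := by
    refine ⟨_, hs1, ?_⟩
    simp only [mem_ofPred_eq, Pi.add_apply, Pi.smul_apply, Pi.single_eq_same, smul_eq_mul, mul_one]
    linarith [ht.2]
  have hpos := hopen.measure_pos volume hne
  have hsub : c.params ∩ interior V ∩ {x | 0 < x 0} ⊆ c.dom ∩ V := fun x hx =>
    ⟨⟨hx.1.1, le_of_lt hx.2⟩, interior_subset hx.1.2⟩
  exact (hpos.trans_le (measure_mono hsub)).ne'

/-- If the pointwise inequality were strict at p, continuity would make it strict on a relatively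
open part of M near p, of positive parameter measure, and the integrals would differ. The partition
is chosen with this neighbourhood inside one piece. -/
theorem isSplitSLAG_of_vol_eq (h : M.IsPositiveSpacelike) (hMc : IsCompact M.carrier)
    (heq : M.vol = calibrationIntegral M) : M.IsSplitSLAG := by
  rintro ⟨p, hp⟩
  obtain ⟨m, π, O, hO, hpO, hpiece⟩ := exists_chartPartition_nhd hMc h.sumMap h.diffMap hp
  set c := π.chart 0 with hc
  have hs : p ∈ c.φ.source := π.subset_source 0 (by rw [hpiece]; exact ⟨hp, hpO⟩)
  have htd := coord_mem_dom hp hs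
  have hparam := param_coord hp hs
  have hmem : ∀ i, c.frame (c.φ p).1 i ∈ tangentSpace M.carrier p := fun i => by
    have h1 := frame_mem_tangentSpace htd i
    rwa [hparam] at h1
  refine (h ⟨p, hp⟩).isSplitSLAGPlane hmem (linearIndependent_frame htd.1) ?_
  by_contra hne
  have hlt : √(gram (c.frame (c.φ p).1)).det < calibration (c.frame (c.φ p).1) :=
    lt_of_le_of_ne ((h ⟨p, hp⟩).sqrt_det_gram_le hmem) hne
  have hnhds := c.isOpen_params.mem_nhds htd.1
  have hV : {t | √(gram (c.frame t)).det < calibration (c.frame t)} ∩ c.param ⁻¹' O ∈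
      𝓝 (c.φ p).1 := by
    refine inter_mem (((continuousOn_sqrt_det_gram c).continuousAt hnhds).eventually_lt
      ((continuousOn_calibration c).continuousAt hnhds) hlt)
      ((continuousOn_param.continuousAt hnhds).preimage_mem_nhds ?_)
    rw [hparam]
    exact hO.mem_nhds hpO
  have hvol := volume_dom_inter_ne_zero c htd hV
  -- Finiteness is essential: in `ENNReal` a strict inequality in one summand survives addition only
  -- if the remaining terms are finite.
  have hfin := (heq.le.trans_lt (calibrationIntegral_lt_top h.sumMap h.diffMap hMc)).ne
  rw [π.vol_eq_sum h.sumMap] at hfin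
  have hle : ∀ k, ∫⁻ t in (π.chart k).paramsOf (π.piece k),
        ENNReal.ofReal √(gram ((π.chart k).frame t)).det ≤
      ∫⁻ t in (π.chart k).paramsOf (π.piece k),
        ENNReal.ofReal (calibration ((π.chart k).frame t)) := fun k =>
    setLIntegral_mono' (measurableSet_paramsOf (π.measurableSet k))
      fun t ht => ENNReal.ofReal_le_ofReal (sqrt_det_gram_frame_le h _ ht.2)
  rw [π.vol_eq_sum h.sumMap, π.calibrationIntegral_eq h.sumMap h.diffMap hMc] at heq
  rw [Fin.sum_univ_succ] at hfin
  rw [Fin.sum_univ_succ, Fin.sum_univ_succ] at heq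
  obtain ⟨hfin₁, hfin₂⟩ := ENNReal.add_ne_top.1 hfin
  refine (ENNReal.add_lt_add_of_lt_of_le hfin₂ ?_
    (Finset.sum_le_sum fun k _ => hle (Fin.succ k))).ne heq
  have hm := measurableSet_paramsOf (c := c) (π.measurableSet 0)
  refine lintegral_strict_mono_of_ae_le_of_ae_lt_on
    (s := {t | √(gram (c.frame t)).det < calibration (c.frame t)})
    (aemeasurable_of_continuousOn c (continuousOn_calibration c) (π.measurableSet 0)) hfin₁
    ((ae_restrict_iff' hm).2 (Eventually.of_forall fun t ht =>
      ENNReal.ofReal_le_ofReal (sqrt_det_gram_frame_le h _ ht.2))) ?_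
    (Eventually.of_forall fun t ht =>
      (ENNReal.ofReal_lt_ofReal_iff_of_nonneg (Real.sqrt_nonneg _)).2 ht)
  rw [Measure.restrict_apply' hm]
  have hsub : c.dom ∩ ({t | √(gram (c.frame t)).det < calibration (c.frame t)} ∩ c.param ⁻¹' O) ⊆
      {t | √(gram (c.frame t)).det < calibration (c.frame t)} ∩ c.paramsOf (π.piece 0) := by
    intro t ht
    refine ⟨ht.2.1, ?_, ht.1⟩
    rw [mem_preimage, hpiece]
    exact ⟨(param_mem ht.1).1, ht.2.2⟩
  exact fun h0 => hvol (measure_mono_null hsub h0)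

/-- Takes the place of Stokes' theorem for the closed form Φ: the integrands, which count fibre
points, agree at every y. -/
theorem calibrationIntegral_eq_of_sameOrientedBoundary {M N : OrientedSubmanifold n}
    (hM₁ : M.IsPositiveFor (sumMap n)) (hM₂ : M.IsPositiveFor (diffMap n))
    (hN₁ : N.IsPositiveFor (sumMap n)) (hN₂ : N.IsPositiveFor (diffMap n))
    (hMc : IsCompact M.carrier) (hNc : IsCompact N.carrier) (h : M.SameOrientedBoundary N) :
    calibrationIntegral M = calibrationIntegral N := by
  simp only [calibrationIntegral, ncard_fiber_eq hMc hNc hM₁ hN₁ h,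
    ncard_fiber_eq hMc hNc hM₂ hN₂ h]

end Calibration

end SplitSLAG

theorem theorem5p3 {n : ℕ} [NeZero n] (M N : SplitSLAG.OrientedSubmanifold n)
    (hMc : IsCompact M.carrier) (hM : M.IsSplitSLAG)
    (hNc : IsCompact N.carrier) (hN : N.IsPositiveSpacelike)
    (hMN : M.SameOrientedBoundary N) :
    N.vol ≤ M.vol ∧ (N.vol = M.vol ↔ N.IsSplitSLAG) := by
  have hMvol := SplitSLAG.vol_eq_calibrationIntegral hM hMc
  rw [SplitSLAG.calibrationIntegral_eq_of_sameOrientedBoundary hM.sumMap hM.diffMap hN.sumMap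
    hN.diffMap hMc hNc hMN] at hMvol
  rw [hMvol]
  exact ⟨SplitSLAG.vol_le_calibrationIntegral hN hNc,
    fun h => SplitSLAG.isSplitSLAG_of_vol_eq hN hNc h,
    fun h => SplitSLAG.vol_eq_calibrationIntegral h hNc⟩
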